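/- All graphs are finite, simple and undirected. The rank and the spectral radius $\rho(G)$ of a graph $G$ are the rank and the spectral radius of its adjacency matrix. For a graph $G$ with vertices $v_1,\dots,v_k$ and positive integers $n_1,\dots,n_k$, let $G\circ(n_1,\dots,n_k)$ be the graph obtained from $G$ by replacing each $v_i$ with an independent set $V_i$ of $n_i$ vertices and joining every vertex of $V_i$ to every vertex of $V_j$ if and only if $v_iv_j\in E(G)$. Let $G_1$ be the graph on $v_1,\dots,v_5$ with edges $v_1v_2,\ v_1v_3,\ v_1v_4,\ v_2v_4,\ v_3v_5$, and let $G_{10}$ be the graph on $v_1,\dots,v_6$ with edges $v_1v_2,\ v_1v_3,\ v_1v_4,\ v_2v_3,\ v_2v_5,\ v_3v_5,\ v_4v_6$. Theorem. Let $n\ge 5$. Among all connected graphs of order $n$ and rank $5$, the minimum spectral radius is attained by exactly one graph up to isomorphism, namely: - the cycle $C_5$, if $n=5$; - $G_1\circ(1,1,1,1,n-4)$, if $6\le n\le 10$; - $G_{10}\circ(1,1,1,1,1,n-5)$, if $n=11$; - $G_{10}\circ(1,1,1,1,k,n-k-4)$ for some $k\in\left\{\left\lfloor\frac{6n-37-\sqrt{24n+1}}{18}\right\rfloor,\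 \left\lceil\frac{6n-37-\sqrt{24n+1}}{18}\right\rceil\right\}$, if $n\ge 12$. -/

import Mathlib

universe u

namespace RankFive

/-- The rank of a graph: the rank of its (real) adjacency matrix. -/
noncomputable def graphRank {V : Type*} [Fintype V] (G : SimpleGraph V) : ℕ :=
  open Classical in (G.adjMatrix ℝ).rank

/-- The spectral radius of a graph: the spectral radius of its adjacency matrix. The matrix is
real symmetric, so all its complex eigenvalues are real and the spectrum over `ℝ` is the whole
spectrum. -/
noncomputable def graphSpectralRadius {V : Type*} [Fintype V] (G : SimpleGraph V) : ENNReal :=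
  open Classical in spectralRadius ℝ (G.adjMatrix ℝ)

/-- Multiplication of vertices `G ∘ m`: the vertex `i` is replaced with an independent set of
`m i` vertices, and copies of `i` and `j` are joined exactly when `i` and `j` are adjacent. -/
def blowup {ι : Type*} (G : SimpleGraph ι) (m : ι → ℕ) : SimpleGraph (Σ i, Fin (m i)) where
  Adj a b := G.Adj a.1 b.1
  symm := ⟨fun _ _ h => G.symm.symm _ _ h⟩
  loopless := ⟨fun a h => G.loopless.irrefl a.1 h⟩

/-- A triangle with a pendant path of length two, on the vertices `v₁, …, v₅` (numbered from `0`):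
edges `v₁v₂, v₁v₃, v₁v₄, v₂v₄, v₃v₅`. -/
def G1 : SimpleGraph (Fin 5) :=
  SimpleGraph.fromEdgeSet {s(0, 1), s(0, 2), s(0, 3), s(1, 3), s(2, 4)}

/-- The graph on the vertices `v₁, …, v₆` (numbered from `0`) with edges
`v₁v₂, v₁v₃, v₁v₄, v₂v₃, v₂v₅, v₃v₅, v₄v₆`. -/
def G10 : SimpleGraph (Fin 6) :=
  SimpleGraph.fromEdgeSet
    {s(0, 1), s(0, 2), s(0, 3), s(1, 2), s(1, 4), s(2, 4), s(3, 5)}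

/-- `G` attains the minimum spectral radius among all connected graphs of order `n` and rank `r`
(and is itself such a graph). -/
def IsMinimizer (n r : ℕ) {V : Type*} [Fintype V] (G : SimpleGraph V) : Prop :=
  Fintype.card V = n ∧ G.Connected ∧ graphRank G = r ∧
    ∀ H : SimpleGraph (Fin n), H.Connected → graphRank H = r →
      graphSpectralRadius G ≤ graphSpectralRadius H

/-- `F` is, up to isomorphism, the graph that attains the minimum spectral radius among all
connected graphs of order `n` and rank `r`. -/
def IsTheMinimizer.{v, w} (n r : ℕ) {W : Type w} [Fintype W] (F : SimpleGraph W) : Prop :=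
  IsMinimizer n r F ∧
    ∀ (V : Type v) [Fintype V] (G : SimpleGraph V), IsMinimizer n r G → Nonempty (G ≃g F)

end RankFive

/-! A positive eigenvector `x` of a connected graph turns lower bounds on walk counts into lower
bounds on the spectral radius `t`. Let `G` be connected of rank five.

If any two non-adjacent vertices have a common neighbour, then every vertex starts at least `n - 1`
walks of length two, so `n - 1 ≤ t²`, which is too large for a minimiser unless `n = 5`, where
equality forces the cycle; for `n = 6` a parity argument sharpens the bound.

Otherwise there are edges `px` and `qy` with `p` and `q` at distance at least three. The adjacency
matrix restricted to `p, x, q, y` is invertible, so its Schur complement has rank one, and being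
symmetric it satisfies `S u v ^ 2 = S u u * S v v`. Evaluating this identity on the neighbours of
`p`, the neighbours of `q` and the remaining vertices leaves three possibilities: two patterns with
seven classes, in which counting walks again gives `n - 1 ≤ t²`, and a complete tripartite graph
linked to a complete bipartite graph. In the last case the eigenvector equation, summed over the
parts, gives `2 ≤ (t² - t - 2m)(t² - s)`, where the tripartite part has `m + 2` vertices and the
bipartite part `s`, with equality exactly for `G₁₀ ∘ (1, 1, 1, 1, m - 1, s - 1)`.

It remains to minimise the root `t` over `m + s = n - 2`. With `P = t² - t - 2m` and `Q = t² - s`,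
comparing neighbouring parameters yields `P ≤ 2Q + 2` and `2Q ≤ P + 2`, while `PQ = 2` forces
`P + 2Q ≥ 4`; together these confine `18m` to an interval of length `36` around
`6n - 19 - √(24n + 1)`. -/

namespace RankFive

open Matrix
open scoped Classical

section NonnegativeMatrix

variable {V : Type*} [Fintype V] {M : Matrix V V ℝ} {t : ℝ} {x : V → ℝ}

lemma dotProduct_mulVec_eq_sum (M : Matrix V V ℝ) (y z : V → ℝ) :
    y ⬝ᵥ M *ᵥ z = ∑ i, ∑ j, M i j * (y i * z j) := by
  simp only [dotProduct, mulVec, Finset.mul_sum]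
  exact Finset.sum_congr rfl fun i _ => Finset.sum_congr rfl fun j _ => by ring

/- Summing `0 ≤ M i j * (z i * x j - z j * x i) ^ 2 / (x i * x j)` over all `i` and `j` gives
twice the difference of the two sides. -/
lemma dotProduct_mulVec_le_of_pos_eigenvector (hM : M.IsSymm) (h0 : ∀ i j, 0 ≤ M i j)
    (hx : ∀ i, 0 < x i) (h : M *ᵥ x = t • x) (z : V → ℝ) :
    z ⬝ᵥ M *ᵥ z ≤ t * (z ⬝ᵥ z) := by
  have hterm : ∀ i j, M i j * (z i * z j) * 2 ≤
      M i j * x j * (z i ^ 2 / x i) + M j i * x i * (z j ^ 2 / x j) := by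
    intro i j
    have hi := hx i
    have hj := hx j
    have hsq : 2 * (z i * z j) ≤ x j * (z i ^ 2 / x i) + x i * (z j ^ 2 / x j) := by
      rw [mul_div_assoc', mul_div_assoc', div_add_div _ _ hi.ne' hj.ne',
        le_div_iff₀ (mul_pos hi hj)]
      nlinarith [sq_nonneg (z i * x j - z j * x i)]
    rw [hM.apply i j]
    linarith [mul_le_mul_of_nonneg_left hsq (h0 i j)]
  have hsum : ∑ i, ∑ j, M i j * x j * (z i ^ 2 / x i) = t * (z ⬝ᵥ z) := by
    rw [dotProduct, Finset.mul_sum]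
    refine Finset.sum_congr rfl fun i _ => ?_
    have hi : ∑ j, M i j * x j = t * x i := congrFun h i
    have := (hx i).ne'
    rw [← Finset.sum_mul, hi]
    field_simp
  have hle := Finset.sum_le_sum fun i (_ : i ∈ Finset.univ) =>
    Finset.sum_le_sum fun j (_ : j ∈ Finset.univ) => hterm i j
  simp only [Finset.sum_add_distrib, ← Finset.sum_mul] at hle
  rw [Finset.sum_comm (f := fun i j => M j i * x i * (z j ^ 2 / x j))] at hle
  simp only [← Finset.sum_mul] at hsum hle
  rw [hsum] at hle
  rw [dotProduct_mulVec_eq_sum]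
  linarith

lemma abs_eigenvalue_le_of_pos_eigenvector (hM : M.IsSymm) (h0 : ∀ i j, 0 ≤ M i j)
    (hx : ∀ i, 0 < x i) (h : M *ᵥ x = t • x) {k : ℝ} {y : V → ℝ} (hy : y ≠ 0)
    (hk : M *ᵥ y = k • y) : |k| ≤ t := by
  have hyy : 0 < y ⬝ᵥ y := by simpa using dotProduct_star_self_pos_iff.mpr hy
  refine le_of_mul_le_mul_right ?_ hyy
  calc |k| * (y ⬝ᵥ y) = |y ⬝ᵥ M *ᵥ y| := by
        rw [hk, dotProduct_smul, smul_eq_mul, abs_mul, abs_of_pos hyy]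
    _ ≤ |y| ⬝ᵥ M *ᵥ |y| := by
        rw [dotProduct_mulVec_eq_sum, dotProduct_mulVec_eq_sum]
        refine (Finset.abs_sum_le_sum_abs _ _).trans (Finset.sum_le_sum fun i _ =>
          (Finset.abs_sum_le_sum_abs _ _).trans_eq (Finset.sum_congr rfl fun j _ => ?_))
        rw [abs_mul, abs_mul, abs_of_nonneg (h0 i j), Pi.abs_apply, Pi.abs_apply]
    _ ≤ t * (|y| ⬝ᵥ |y|) := dotProduct_mulVec_le_of_pos_eigenvector hM h0 hx h _
    _ = t * (y ⬝ᵥ y) := by simp only [dotProduct, Pi.abs_apply, abs_mul_abs_self]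

lemma spectralRadius_eq_of_pos_eigenvector [Nonempty V] (hM : M.IsSymm)
    (h0 : ∀ i j, 0 ≤ M i j) (hx : ∀ i, 0 < x i) (h : M *ᵥ x = t • x) :
    spectralRadius ℝ M = ENNReal.ofReal t := by
  have hspec : ∀ k : ℝ, k ∈ spectrum ℝ M ↔ ∃ y : V → ℝ, y ≠ 0 ∧ M *ᵥ y = k • y := by
    intro k
    rw [← Matrix.spectrum_toLin', ← Module.End.hasEigenvalue_iff_mem_spectrum]
    refine ⟨fun hk => ?_, fun ⟨y, hy, hyk⟩ => Module.End.hasEigenvalue_of_hasEigenvector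
      ⟨Module.End.mem_eigenspace_iff.mpr hyk, hy⟩⟩
    obtain ⟨y, hy⟩ := hk.exists_hasEigenvector
    exact ⟨y, hy.2, hy.apply_eq_smul⟩
  have hx0 : x ≠ 0 := fun h0 => (hx (Classical.arbitrary V)).ne' (congrFun h0 _)
  have ht : |t| = t :=
    le_antisymm (abs_eigenvalue_le_of_pos_eigenvector hM h0 hx h hx0 h) (le_abs_self t)
  have hnorm : ∀ k : ℝ, (‖k‖₊ : ENNReal) = ENNReal.ofReal |k| := fun k =>
    (Real.enorm_eq_ofReal_abs k)
  rw [spectralRadius]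
  refine le_antisymm (iSup₂_le fun k hk => ?_)
    (le_iSup₂_of_le t ((hspec t).mpr ⟨x, hx0, h⟩) (by rw [hnorm, ht]))
  obtain ⟨y, hy, hyk⟩ := (hspec k).mp hk
  rw [hnorm]
  exact ENNReal.ofReal_le_ofReal (abs_eigenvalue_le_of_pos_eigenvector hM h0 hx h hy hyk)

/- A maximiser of the quadratic form on the unit sphere is an eigenvector, and taking absolute
values of its coordinates keeps it a maximiser. -/
lemma exists_nonneg_eigenvector [Nonempty V] (hM : M.IsSymm) (h0 : ∀ i j, 0 ≤ M i j) :
    ∃ (t : ℝ) (x : V → ℝ), x ≠ 0 ∧ 0 ≤ x ∧ M *ᵥ x = t • x := by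
  set T := Matrix.toEuclideanCLM (n := V) (𝕜 := ℝ) M with hT
  have hTs : IsSelfAdjoint T := by
    rw [hT, IsSelfAdjoint, ← map_star]
    exact congrArg _ hM
  have hq : ∀ z : EuclideanSpace ℝ V, T.reApplyInnerSelf z =
      ∑ i, ∑ j, M i j * (z i * z j) := fun z => by
    rw [ContinuousLinearMap.reApplyInnerSelf_apply, real_inner_comm, hT,
      Matrix.inner_toEuclideanCLM, RCLike.re_to_real, ← dotProduct_mulVec_eq_sum]
  obtain ⟨z, hz, hmax⟩ := (isCompact_sphere (0 : EuclideanSpace ℝ V) 1).exists_isMaxOn (by simp)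
    T.reApplyInnerSelf_continuous.continuousOn
  set y : EuclideanSpace ℝ V := WithLp.toLp 2 fun i => |z i| with hy
  have hnorm : ‖y‖ = 1 := by
    rw [← mem_sphere_zero_iff_norm.mp hz, EuclideanSpace.norm_eq, EuclideanSpace.norm_eq]
    simp [hy]
  have hy0 : y ≠ 0 := by
    rw [← norm_ne_zero_iff, hnorm]
    exact one_ne_zero
  have hymax : IsMaxOn T.reApplyInnerSelf (Metric.sphere 0 ‖y‖) y := by
    rw [hnorm]
    intro w hw
    have hwz : T.reApplyInnerSelf w ≤ T.reApplyInnerSelf z := hmax hw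
    refine hwz.trans ?_
    rw [hq, hq]
    refine Finset.sum_le_sum fun i _ => Finset.sum_le_sum fun j _ =>
      mul_le_mul_of_nonneg_left ?_ (h0 i j)
    simpa [hy, abs_mul] using le_abs_self (z i * z j)
  exact ⟨_, y.ofLp, fun h => hy0 (PiLp.ext (congrFun h)), fun i => abs_nonneg (z i),
    congrArg WithLp.ofLp (hTs.hasEigenvector_of_isMaxOn hy0 hymax).apply_eq_smul⟩

end NonnegativeMatrix

/-- `x` is a positive eigenvector of the adjacency matrix of `G` with eigenvalue `t`, that is, a
Perron vector; for connected `G` the eigenvalue is then the spectral radius. -/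
structure IsPerron {V : Type*} [Fintype V] (G : SimpleGraph V) (t : ℝ) (x : V → ℝ) : Prop where
  pos : ∀ v, 0 < x v
  eq : G.adjMatrix ℝ *ᵥ x = t • x

lemma adjMatrix_nonneg {V : Type*} (G : SimpleGraph V) (u v : V) : 0 ≤ G.adjMatrix ℝ u v := by
  rw [SimpleGraph.adjMatrix_apply]
  positivity

section Perron

variable {V W : Type*} [Fintype V] [Fintype W] {G : SimpleGraph V} {H : SimpleGraph W}

theorem exists_isPerron (hG : G.Connected) : ∃ (t : ℝ) (x : V → ℝ), IsPerron G t x := by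
  have := hG.nonempty
  obtain ⟨t, x, hx0, hx, h⟩ :=
    exists_nonneg_eigenvector G.isSymm_adjMatrix (adjMatrix_nonneg G)
  have hzero : ∀ {u v}, G.Adj u v → x u = 0 → x v = 0 := fun {u v} huv hu => by
    have hsum : ∑ w ∈ G.neighborFinset u, x w = 0 := by
      rw [← SimpleGraph.adjMatrix_mulVec_apply, h, Pi.smul_apply, hu, smul_zero]
    exact (Finset.sum_eq_zero_iff_of_nonneg fun w _ => hx w).mp hsum v (by simpa using huv)
  have hwalk : ∀ {u v}, G.Walk u v → x u = 0 → x v = 0 := fun p => by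
    induction p with
    | nil => exact id
    | cons hadj _ ih => exact fun hu => ih (hzero hadj hu)
  refine ⟨t, x, fun v => lt_of_le_of_ne (hx v) fun hv => hx0 (funext fun w => ?_), h⟩
  exact hwalk (hG v w).some hv.symm

namespace IsPerron

variable {t : ℝ} {x : V → ℝ}

lemma sum_neighborFinset (h : IsPerron G t x) (v : V) :
    ∑ u ∈ G.neighborFinset v, x u = t * x v := by
  rw [← SimpleGraph.adjMatrix_mulVec_apply, h.eq, Pi.smul_apply, smul_eq_mul]

lemma of_sum_neighborFinset (hx : ∀ v, 0 < x v)
    (h : ∀ v, ∑ u ∈ G.neighborFinset v, x u = t * x v) : IsPerron G t x :=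
  ⟨hx, funext fun v => (SimpleGraph.adjMatrix_mulVec_apply ..).trans (h v)⟩

lemma sum_pos (h : IsPerron G t x) {I : Finset V} (hI : I.Nonempty) : 0 < ∑ v ∈ I, x v :=
  Finset.sum_pos (fun v _ => h.pos v) hI

lemma sum_nonneg (h : IsPerron G t x) (I : Finset V) : 0 ≤ ∑ v ∈ I, x v :=
  Finset.sum_nonneg fun v _ => (h.pos v).le

lemma nonneg [Nonempty V] (h : IsPerron G t x) : 0 ≤ t :=
  let v := Classical.arbitrary V
  nonneg_of_mul_nonneg_left ((h.sum_nonneg _).trans_eq (h.sum_neighborFinset v)) (h.pos v)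

lemma graphSpectralRadius_eq [Nonempty V] (h : IsPerron G t x) :
    graphSpectralRadius G = ENNReal.ofReal t :=
  spectralRadius_eq_of_pos_eigenvector G.isSymm_adjMatrix (adjMatrix_nonneg G) h.pos h.eq

lemma graphSpectralRadius_le_iff [Nonempty V] [Nonempty W] {t' : ℝ} {y : W → ℝ}
    (h : IsPerron G t x) (h' : IsPerron H t' y) :
    graphSpectralRadius G ≤ graphSpectralRadius H ↔ t ≤ t' := by
  rw [h.graphSpectralRadius_eq, h'.graphSpectralRadius_eq, ENNReal.ofReal_le_ofReal_iff h'.nonneg]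

lemma iso (h : IsPerron G t x) (e : H ≃g G) : IsPerron H t (x ∘ e) := by
  refine of_sum_neighborFinset (fun v => h.pos _) fun v => ?_
  rw [Function.comp_apply, ← h.sum_neighborFinset]
  refine Finset.sum_equiv e.toEquiv (fun u => ?_) fun u _ => rfl
  simp [e.map_adj_iff]

lemma sum_le_mul (h : IsPerron G t x) {u : V} {T : Finset V} (hT : ∀ v ∈ T, G.Adj u v) :
    ∑ v ∈ T, x v ≤ t * x u := by
  rw [← h.sum_neighborFinset]
  exact Finset.sum_le_sum_of_subset_of_nonneg (fun v hv => by simpa using hT v hv)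
    fun v _ _ => (h.pos v).le

lemma card_mul_sum_le (h : IsPerron G t x) {I T : Finset V}
    (hIT : ∀ u ∈ I, ∀ v ∈ T, G.Adj u v) : I.card * ∑ v ∈ T, x v ≤ t * ∑ v ∈ I, x v := by
  rw [← nsmul_eq_mul, Finset.mul_sum]
  exact Finset.card_nsmul_le_sum _ _ _ fun u hu => h.sum_le_mul (hIT u hu)

lemma card_mul_sum_add_le (h : IsPerron G t x) {I T : Finset V} {E : V → Finset V}
    (hIT : ∀ u ∈ I, ∀ v ∈ T, G.Adj u v) (hE : ∀ u ∈ I, ∀ v ∈ E u, G.Adj u v)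
    (hTE : ∀ u ∈ I, Disjoint T (E u)) :
    I.card * ∑ v ∈ T, x v + ∑ u ∈ I, ∑ v ∈ E u, x v ≤ t * ∑ v ∈ I, x v := by
  rw [← nsmul_eq_mul, ← Finset.sum_const, ← Finset.sum_add_distrib, Finset.mul_sum]
  refine Finset.sum_le_sum fun u hu => ?_
  rw [← Finset.sum_union (hTE u hu)]
  exact h.sum_le_mul fun v hv => (Finset.mem_union.mp hv).elim (hIT u hu v) (hE u hu v)

end IsPerron

lemma graphSpectralRadius_iso (e : G ≃g H) (hG : G.Connected) :
    graphSpectralRadius G = graphSpectralRadius H := by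
  have := hG.nonempty
  have := (e.connected_iff.mp hG).nonempty
  obtain ⟨t, x, h⟩ := exists_isPerron (e.connected_iff.mp hG)
  rw [(h.iso e).graphSpectralRadius_eq, h.graphSpectralRadius_eq]

end Perron

section Rank

variable {V W : Type*} [Fintype V] [Fintype W]

lemma graphRank_comap_le (G : SimpleGraph W) (f : V → W) : graphRank (G.comap f) ≤ graphRank G :=
  (congrArg Matrix.rank (by ext; simp)).trans_le (rank_submatrix_le (G.adjMatrix ℝ) f f)

lemma graphRank_iso {G : SimpleGraph V} {H : SimpleGraph W} (e : G ≃g H) :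
    graphRank G = graphRank H := by
  have hG : H.comap e = G := SimpleGraph.ext (funext₂ fun _ _ => propext e.map_adj_iff)
  have hH : G.comap e.symm = H := SimpleGraph.ext (funext₂ fun _ _ => propext e.symm.map_adj_iff)
  exact le_antisymm (hG ▸ graphRank_comap_le H e) (hH ▸ graphRank_comap_le G e.symm)

lemma graphRank_le_card (G : SimpleGraph V) : graphRank G ≤ Fintype.card V :=
  rank_le_card_width _

lemma graphRank_eq_card_iff {G : SimpleGraph V} : graphRank G = Fintype.card V ↔
    ∀ z : V → ℝ, (∀ v, ∑ u ∈ G.neighborFinset v, z u = 0) → z = 0 := by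
  have hker := (mulVecLin (G.adjMatrix ℝ)).finrank_range_add_finrank_ker
  rw [Module.finrank_fintype_fun_eq_card] at hker
  have hrank : graphRank G = Fintype.card V ↔ LinearMap.ker (mulVecLin (G.adjMatrix ℝ)) = ⊥ := by
    rw [← Submodule.finrank_eq_zero (R := ℝ), ← hker]
    exact Nat.left_eq_add
  rw [hrank, LinearMap.ker_eq_bot']
  simp only [mulVecLin_apply, funext_iff, SimpleGraph.adjMatrix_mulVec_apply, Pi.zero_apply]

end Rank

section Minimizer

variable {V W : Type*} [Fintype V] [Fintype W] {G : SimpleGraph V} {H : SimpleGraph W} {n r : ℕ}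

lemma IsMinimizer.of_iso (h : IsMinimizer n r G) (e : G ≃g H) : IsMinimizer n r H := by
  obtain ⟨hcard, hconn, hrank, hmin⟩ := h
  refine ⟨(Fintype.card_congr e.toEquiv).symm.trans hcard, e.connected_iff.mp hconn,
    (graphRank_iso e).symm.trans hrank, fun K hK hKr => ?_⟩
  rw [← graphSpectralRadius_iso e hconn]
  exact hmin K hK hKr

lemma IsTheMinimizer.of_iso (h : IsTheMinimizer.{u} n r G) (e : G ≃g H) :
    IsTheMinimizer.{u} n r H :=
  ⟨h.1.of_iso e, fun V _ K hK => (h.2 V K hK).map fun e' => e'.trans e⟩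

lemma IsMinimizer.graphSpectralRadius_le (h : IsMinimizer n r G) (hn : Fintype.card W = n)
    (hH : H.Connected) (hr : graphRank H = r) : graphSpectralRadius G ≤ graphSpectralRadius H := by
  have e := H.overFinIso hn
  rw [graphSpectralRadius_iso e hH]
  exact h.2.2.2 _ (e.connected_iff.mp hH) ((graphRank_iso e).symm.trans hr)

lemma IsPerron.isTheMinimizer [Nonempty V] {t : ℝ} {x : V → ℝ} (hx : IsPerron G t x)
    (hn : Fintype.card V = n) (hG : G.Connected) (hr : graphRank G = r)
    (hmin : ∀ {K : SimpleGraph (Fin n)} {τ : ℝ} {y : Fin n → ℝ}, K.Connected → graphRank K = r →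
      IsPerron K τ y → t ≤ τ ∧ (τ = t → Nonempty (K ≃g G))) : IsTheMinimizer.{u} n r G := by
  refine ⟨⟨hn, hG, hr, fun K hK hKr => ?_⟩, fun W _ K hK => ?_⟩
  · have := hK.nonempty
    obtain ⟨τ, y, hy⟩ := exists_isPerron hK
    exact (hx.graphSpectralRadius_le_iff hy).mpr (hmin hK hKr hy).1
  · have e := K.overFinIso hK.1
    have hK' := hK.of_iso e
    have := hK'.2.1.nonempty
    obtain ⟨τ, y, hy⟩ := exists_isPerron hK'.2.1
    have hτ : τ ≤ t := (hy.graphSpectralRadius_le_iff hx).mp (hK'.graphSpectralRadius_le hn hG hr)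
    obtain ⟨hle, hiso⟩ := hmin hK'.2.1 hK'.2.2.1 hy
    exact (hiso (le_antisymm hτ hle)).map e.trans

end Minimizer

section ColourClass

variable {V ι : Type*} [Fintype V] {κ : V → ι} {i j : ι}

/-- The set of vertices to which the colouring `κ` gives the colour `i`. -/
noncomputable def colourClass (κ : V → ι) (i : ι) : Finset V :=
  {v | κ v = i}

lemma mem_colourClass {v : V} : v ∈ colourClass κ i ↔ κ v = i := by
  rw [colourClass, Finset.mem_filter_univ]

lemma disjoint_colourClass (h : i ≠ j) : Disjoint (colourClass κ i) (colourClass κ j) :=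
  Finset.disjoint_left.mpr fun _ hi hj => h <|
    (mem_colourClass.mp hi).symm.trans (mem_colourClass.mp hj)

lemma sum_card_colourClass [Fintype ι] (κ : V → ι) :
    ∑ i, (colourClass κ i).card = Fintype.card V :=
  (Finset.card_eq_sum_card_fiberwise fun v _ => Finset.mem_univ (κ v)).symm

end ColourClass

section Blowup

variable {V ι : Type*} [Fintype V] {G : SimpleGraph V} {H : SimpleGraph ι} {m : ι → ℕ}

lemma nonempty_iso_blowup (f : V → ι) (hf : ∀ i, (colourClass f i).card = m i)
    (hG : G = H.comap f) : Nonempty (G ≃g blowup H m) := by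
  have hcard : ∀ i, Fintype.card {v // f v = i} = m i := fun i =>
    (Fintype.card_subtype _).trans (hf i)
  subst hG
  exact ⟨⟨(Equiv.sigmaFiberEquiv f).symm.trans
    (Equiv.sigmaCongrRight fun i => Fintype.equivFinOfCardEq (hcard i)), Iff.rfl⟩⟩

lemma isPerron_blowup [Fintype ι] {t : ℝ} {w : ι → ℝ} (hw : ∀ i, 0 < w i)
    (h : ∀ i, ∑ j ∈ H.neighborFinset i, m j * w j = t * w i) :
    IsPerron (blowup H m) t fun v => w v.1 := by
  refine .of_sum_neighborFinset (fun v => hw v.1) fun v => ?_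
  have hN : (blowup H m).neighborFinset v = (H.neighborFinset v.1).sigma fun _ => Finset.univ := by
    ext u
    rw [SimpleGraph.mem_neighborFinset, Finset.mem_sigma, SimpleGraph.mem_neighborFinset]
    exact (and_iff_left (Finset.mem_univ _)).symm
  rw [hN, Finset.sum_sigma, ← h v.1]
  simp only [Finset.sum_const, Finset.card_univ, Fintype.card_fin, nsmul_eq_mul]

end Blowup

section ExtremalGraph

lemma G1_adj_iff (i j : Fin 5) : G1.Adj i j ↔
    (i, j) ∈ ({(0, 1), (1, 0), (0, 2), (2, 0), (0, 3), (3, 0), (1, 3), (3, 1),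
      (2, 4), (4, 2)} : Finset (Fin 5 × Fin 5)) := by
  fin_cases i <;> fin_cases j <;> simp [G1]

lemma G10_adj_iff (i j : Fin 6) : G10.Adj i j ↔
    (i, j) ∈ ({(0, 1), (1, 0), (0, 2), (2, 0), (0, 3), (3, 0), (1, 2), (2, 1), (1, 4), (4, 1),
      (2, 4), (4, 2), (3, 5), (5, 3)} : Finset (Fin 6 × Fin 6)) := by
  fin_cases i <;> fin_cases j <;> simp [G10]

lemma G1_eq_comap_G10 : G1 = G10.comap ![0, 1, 3, 2, 5] := by
  ext i j
  rw [SimpleGraph.comap_adj, G1_adj_iff, G10_adj_iff]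
  revert i j
  decide

lemma sum_neighborFinset_G1 (w : Fin 5 → ℝ) (i : Fin 5) : ∑ j ∈ G1.neighborFinset i, w j =
    ![w 1 + w 2 + w 3, w 0 + w 3, w 0 + w 4, w 0 + w 1, w 2] i := by
  rw [SimpleGraph.neighborFinset_eq_filter, Finset.sum_filter, Fin.sum_univ_five]
  fin_cases i <;> simp [G1_adj_iff]

lemma sum_neighborFinset_G10 (w : Fin 6 → ℝ) (i : Fin 6) : ∑ j ∈ G10.neighborFinset i, w j =
    ![w 1 + w 2 + w 3, w 0 + w 2 + w 4, w 0 + w 1 + w 4, w 0 + w 5, w 1 + w 2, w 3] i := by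
  rw [SimpleGraph.neighborFinset_eq_filter, Finset.sum_filter, Fin.sum_univ_six]
  fin_cases i <;> simp [G10_adj_iff]

lemma graphRank_G1 : graphRank G1 = 5 := by
  refine (graphRank_eq_card_iff.mpr fun z hz => ?_).trans (Fintype.card_fin 5)
  simp only [sum_neighborFinset_G1] at hz
  have h0 : z 1 + z 2 + z 3 = 0 := hz 0
  have h1 : z 0 + z 3 = 0 := hz 1
  have h2 : z 0 + z 4 = 0 := hz 2
  have h3 : z 0 + z 1 = 0 := hz 3
  have h4 : z 2 = 0 := hz 4
  have h : z 0 = 0 ∧ z 1 = 0 ∧ z 2 = 0 ∧ z 3 = 0 ∧ z 4 = 0 := by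
    refine ⟨?_, ?_, ?_, ?_, ?_⟩ <;> linarith
  ext i
  fin_cases i
  exacts [h.1, h.2.1, h.2.2.1, h.2.2.2.1, h.2.2.2.2]

lemma graphRank_G10_le : graphRank G10 ≤ 5 := by
  refine Nat.lt_succ_iff.mp (lt_of_le_of_ne (graphRank_le_card G10) fun h => ?_)
  have hz := graphRank_eq_card_iff.mp h ![1, 0, 0, 0, -1, -1] fun i => by
    rw [sum_neighborFinset_G10]
    fin_cases i <;> simp
  simpa using congrFun hz 0

lemma connected_blowup_G10 (k j : ℕ) : (blowup G10 ![1, 1, 1, 1, k, j]).Connected := by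
  set G := blowup G10 ![1, 1, 1, 1, k, j]
  have hadj : ∀ {u v}, G10.Adj (Sigma.fst u) v.1 → G.Reachable u v :=
    fun h => SimpleGraph.Adj.reachable (G := G) h
  have hreach : ∀ v, G.Reachable v ⟨0, (0 : Fin 1)⟩ := by
    rintro ⟨i, a⟩
    fin_cases i
    · obtain rfl : a = (0 : Fin 1) := Subsingleton.elim (α := Fin 1) a 0
      rfl
    · exact hadj (by simp [G10])
    · exact hadj (by simp [G10])
    · exact hadj (by simp [G10])
    · exact (hadj (v := ⟨1, (0 : Fin 1)⟩) (by simp [G10])).trans (hadj (by simp [G10]))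
    · exact (hadj (v := ⟨3, (0 : Fin 1)⟩) (by simp [G10])).trans (hadj (by simp [G10]))
  exact SimpleGraph.connected_iff_exists_forall_reachable _ |>.mpr
    ⟨⟨0, (0 : Fin 1)⟩, fun v => (hreach v).symm⟩

lemma card_blowup_G10 (k j : ℕ) :
    Fintype.card (Σ i, Fin ((![1, 1, 1, 1, k, j] : Fin 6 → ℕ) i)) = k + j + 4 := by
  simp only [Fintype.card_sigma, Fintype.card_fin, Fin.sum_univ_six]
  simp +arith

lemma graphRank_blowup_G10 (k : ℕ) {j : ℕ} (hj : 0 < j) :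
    graphRank (blowup G10 ![1, 1, 1, 1, k, j]) = 5 := by
  refine le_antisymm ((graphRank_comap_le G10 Sigma.fst).trans graphRank_G10_le) ?_
  let f : Fin 5 → Σ i, Fin ((![1, 1, 1, 1, k, j] : Fin 6 → ℕ) i) :=
    ![⟨0, (0 : Fin 1)⟩, ⟨1, (0 : Fin 1)⟩, ⟨3, (0 : Fin 1)⟩, ⟨2, (0 : Fin 1)⟩,
      ⟨5, (⟨0, hj⟩ : Fin j)⟩]
  have hf : (blowup G10 ![1, 1, 1, 1, k, j]).comap f = G1 := by
    ext i l
    rw [G1_eq_comap_G10]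
    change G10.Adj (f i).1 (f l).1 ↔ G10.Adj _ _
    fin_cases i <;> fin_cases l <;> rfl
  calc 5 = graphRank G1 := graphRank_G1.symm
    _ ≤ _ := hf ▸ graphRank_comap_le _ f

lemma exists_isPerron_blowup_G10 {k j : ℕ} {t : ℝ} (ht : 0 < t)
    (hP : 0 < t ^ 2 - t - 2 * ((k : ℝ) + 1))
    (h : (t ^ 2 - t - 2 * ((k : ℝ) + 1)) * (t ^ 2 - (j + 1)) = 2) :
    ∃ x, IsPerron (blowup G10 ![1, 1, 1, 1, k, j]) t x := by
  set P := t ^ 2 - t - 2 * ((k : ℝ) + 1)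
  refine ⟨_, isPerron_blowup (w := ![(P + 2) / t, 1, 1, P, 2 / t, P / t]) ?_ ?_⟩
  · intro i
    fin_cases i
    exacts [show 0 < (P + 2) / t by positivity, one_pos, one_pos, hP,
      show 0 < 2 / t by positivity, show 0 < P / t by positivity]
  · intro i
    rw [sum_neighborFinset_G10]
    fin_cases i <;> simp <;> field_simp
    · ring
    · linarith
    · linarith
    · linarith
    · norm_num

lemma nonempty_iso_blowup_G1 (j : ℕ) :
    Nonempty (blowup G1 ![1, 1, 1, 1, j] ≃g blowup G10 ![1, 1, 1, 1, 0, j]) := by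
  refine nonempty_iso_blowup (fun v => (![0, 1, 3, 2, 5] : Fin 5 → Fin 6) v.1) (fun i => ?_) ?_
  · have hclass : colourClass (fun v : Σ l, Fin ((![1, 1, 1, 1, j] : Fin 5 → ℕ) l) =>
        (![0, 1, 3, 2, 5] : Fin 5 → Fin 6) v.1) i =
        Finset.sigma {l | (![0, 1, 3, 2, 5] : Fin 5 → Fin 6) l = i} fun _ => Finset.univ := by
      ext v
      rw [mem_colourClass, Finset.mem_sigma, Finset.mem_filter_univ]
      exact (and_iff_left (Finset.mem_univ _)).symm
    rw [hclass, Finset.card_sigma, Finset.sum_filter, Fin.sum_univ_five]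
    simp only [Finset.card_univ, Fintype.card_fin]
    fin_cases i <;> simp
  · ext u v
    change G1.Adj u.1 v.1 ↔ _
    rw [G1_eq_comap_G10]
    rfl

lemma sum_neighborFinset_cycleGraph_five (w : Fin 5 → ℝ) (i : Fin 5)
    [Fintype ((SimpleGraph.cycleGraph 5).neighborSet i)] :
    ∑ j ∈ (SimpleGraph.cycleGraph 5).neighborFinset i, w j = w (i - 1) + w (i + 1) := by
  have hN : (SimpleGraph.cycleGraph 5).neighborFinset i = {i - 1, i + 1} := by
    convert SimpleGraph.cycleGraph_neighborFinset
  rw [hN, Finset.sum_pair]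
  exact (by decide : ∀ i : Fin 5, i - 1 ≠ i + 1) i

lemma isPerron_cycleGraph_five : IsPerron (SimpleGraph.cycleGraph 5) 2 fun _ => 1 := by
  refine .of_sum_neighborFinset (fun _ => one_pos) fun v => ?_
  rw [sum_neighborFinset_cycleGraph_five]
  norm_num

lemma graphRank_cycleGraph_five : graphRank (SimpleGraph.cycleGraph 5) = 5 := by
  refine (graphRank_eq_card_iff.mpr fun z hz => ?_).trans (Fintype.card_fin 5)
  simp only [sum_neighborFinset_cycleGraph_five] at hz
  have h0 : z 4 + z 1 = 0 := hz 0
  have h1 : z 0 + z 2 = 0 := hz 1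
  have h2 : z 1 + z 3 = 0 := hz 2
  have h3 : z 2 + z 4 = 0 := hz 3
  have h4 : z 3 + z 0 = 0 := hz 4
  have h : z 0 = 0 ∧ z 1 = 0 ∧ z 2 = 0 ∧ z 3 = 0 ∧ z 4 = 0 := by
    refine ⟨?_, ?_, ?_, ?_, ?_⟩ <;> linarith
  ext i
  fin_cases i
  exacts [h.1, h.2.1, h.2.2.1, h.2.2.2.1, h.2.2.2.2]

end ExtremalGraph

section SchurComplement

variable {m n k l K : Type*} [Fintype k] [DecidableEq k] [Field K]

/-- The Schur complement in `M` of the block on the rows `r` and columns `c`, kept as a matrix on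
all rows and columns; it vanishes on the rows `r` and the columns `c` if the block is invertible. -/
noncomputable def schurComplement (M : Matrix m n K) (r : k → m) (c : k → n) : Matrix m n K :=
  M - M.submatrix id c * (M.submatrix r c)⁻¹ * M.submatrix r id

variable {M : Matrix m n K} {r : k → m} {c : k → n}

lemma det_submatrix_schurComplement [Fintype n] [Fintype l] [DecidableEq l]
    (hB : IsUnit (M.submatrix r c))
    (hr : M.rank < Fintype.card k + Fintype.card l) (f : l → m) (g : l → n) :
    ((schurComplement M r c).submatrix f g).det = 0 := by
  have := hB.invertible
  have hblocks : M.submatrix (Sum.elim r f) (Sum.elim c g) = fromBlocks (M.submatrix r c)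
      (M.submatrix r g) (M.submatrix f c) (M.submatrix f g) := by
    ext (i | i) (j | j) <;> rfl
  have hdet : (M.submatrix (Sum.elim r f) (Sum.elim c g)).det = 0 := by
    by_contra hne
    have hle := rank_submatrix_le M (Sum.elim r f) (Sum.elim c g)
    rw [rank_of_det_ne_zero hne, Fintype.card_sum] at hle
    omega
  rw [hblocks, det_fromBlocks₁₁, invOf_eq_nonsing_inv] at hdet
  exact (mul_eq_zero.mp hdet).resolve_left ((isUnit_iff_isUnit_det _).mp hB).ne_zero

lemma rank_le_of_schurComplement_eq_zero [Fintype n] (h : schurComplement M r c = 0) :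
    M.rank ≤ Fintype.card k := by
  rw [sub_eq_zero.mp h]
  exact (rank_mul_le_left _ _).trans <| (rank_mul_le_right _ _).trans (rank_le_card_width _)

end SchurComplement

/-- `px` and `qy` are edges whose ends `p`, `q` are at distance at least three. -/
structure FarEdges {V : Type*} (G : SimpleGraph V) (p x q y : V) : Prop where
  px : G.Adj p x
  qy : G.Adj q y
  pq : ¬ G.Adj p q
  common : ∀ w, G.Adj p w → ¬ G.Adj q w

namespace FarEdges

variable {V : Type*} {G : SimpleGraph V} {p x q y u v w : V}

lemma symm (h : FarEdges G p x q y) : FarEdges G q y p x :=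
  ⟨h.qy, h.px, fun h' => h.pq h'.symm, fun w h1 h2 => h.common w h2 h1⟩

/-- The Schur complement of the adjacency matrix with respect to the rows and columns `p`, `x`,
`q`, `y`; it measures how far adjacency is from being determined by these four vertices. -/
noncomputable def schur (_ : FarEdges G p x q y) : Matrix V V ℝ :=
  schurComplement (G.adjMatrix ℝ) ![p, x, q, y] ![p, x, q, y]

lemma mul_block (h : FarEdges G p x q y) :
    (G.adjMatrix ℝ).submatrix ![p, x, q, y] ![p, x, q, y] *
      !![0, 1, -G.adjMatrix ℝ x y, 0; 1, 0, 0, 0; -G.adjMatrix ℝ x y, 0, 0, 1; 0, 0, 1, 0] = 1 := by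
  have hpy : ¬ G.Adj p y := fun h' => h.common _ h' h.qy
  have hqx : ¬ G.Adj q x := h.common _ h.px
  ext i j
  rw [Matrix.mul_apply, Fin.sum_univ_four]
  fin_cases i <;> fin_cases j <;>
    simp [h.px, h.qy, h.pq, hpy, hqx, h.px.symm, h.qy.symm,
      G.adj_comm q p, G.adj_comm y p, G.adj_comm x q, G.adj_comm y x]

lemma schur_apply (h : FarEdges G p x q y) (u v : V) : h.schur u v =
    G.adjMatrix ℝ u v -
      G.adjMatrix ℝ u p * G.adjMatrix ℝ x v - G.adjMatrix ℝ u x * G.adjMatrix ℝ p v -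
      G.adjMatrix ℝ u q * G.adjMatrix ℝ y v - G.adjMatrix ℝ u y * G.adjMatrix ℝ q v +
      G.adjMatrix ℝ x y *
        (G.adjMatrix ℝ u p * G.adjMatrix ℝ q v + G.adjMatrix ℝ u q * G.adjMatrix ℝ p v) := by
  rw [schur, schurComplement, inv_eq_right_inv h.mul_block, Matrix.sub_apply, Matrix.mul_apply]
  simp [Matrix.mul_apply, Fin.sum_univ_four, -SimpleGraph.adjMatrix_apply]
  ring

lemma schur_comm (h : FarEdges G p x q y) (u v : V) : h.schur u v = h.schur v u := by
  have hA := (SimpleGraph.isSymm_adjMatrix (α := ℝ) G).apply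
  rw [h.schur_apply, h.schur_apply, hA v u, hA u p, hA u x, hA u q, hA u y,
    hA v p, hA v x, hA v q, hA v y]
  ring

lemma schur_self (h : FarEdges G p x q y) (hu : G.Adj p u) :
    h.schur u u = -2 * G.adjMatrix ℝ x u := by
  simp only [h.schur_apply, SimpleGraph.adjMatrix_apply, G.adj_comm u, hu, h.common u hu,
    SimpleGraph.irrefl, if_true, if_false]
  ring

lemma schur_self' (h : FarEdges G p x q y) (hv : G.Adj q v) :
    h.schur v v = -2 * G.adjMatrix ℝ y v := by
  have hpv : ¬ G.Adj p v := fun h' => h.common v h' hv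
  simp only [h.schur_apply, SimpleGraph.adjMatrix_apply, G.adj_comm v, hv, hpv,
    SimpleGraph.irrefl, if_true, if_false]
  ring

lemma schur_cross (h : FarEdges G p x q y) (hu : G.Adj p u) (hv : G.Adj q v) : h.schur u v =
    G.adjMatrix ℝ u v - G.adjMatrix ℝ x v - G.adjMatrix ℝ u y + G.adjMatrix ℝ x y := by
  have hpv : ¬ G.Adj p v := fun h' => h.common v h' hv
  simp only [h.schur_apply, SimpleGraph.adjMatrix_apply, G.adj_comm u p, G.adj_comm u q, hu, hv,
    hpv, h.common u hu, if_true, if_false]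
  ring

variable [Fintype V]

lemma schur_sq (h : FarEdges G p x q y) (hr : graphRank G = 5) (u v : V) :
    h.schur u v ^ 2 = h.schur u u * h.schur v v := by
  have hdet := det_submatrix_schurComplement (IsUnit.of_mul_eq_one _ h.mul_block)
    (hr.trans_lt (by simp)) ![u, v] ![u, v]
  rw [det_fin_two, sub_eq_zero] at hdet
  rw [sq]
  nth_rw 2 [h.schur_comm u v]
  exact hdet.symm

lemma schur_eq_zero (h : FarEdges G p x q y) (hr : graphRank G = 5) (hw : h.schur w w = 0) (v : V) :
    h.schur w v = 0 :=
  pow_eq_zero_iff two_ne_zero |>.mp <| by rw [h.schur_sq hr w v, hw, zero_mul]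

lemma exists_schur_ne_zero (h : FarEdges G p x q y) (hr : graphRank G = 5) :
    ∃ u, h.schur u u ≠ 0 := by
  by_contra! h0
  have hle := rank_le_of_schurComplement_eq_zero (Matrix.ext fun u v => h.schur_eq_zero hr (h0 u) v)
  exact absurd (hr.symm.trans_le hle) (by simp)

lemma schur_outer (h : FarEdges G p x q y) (hr : graphRank G = 5) (hp : ¬ G.Adj p w)
    (hq : ¬ G.Adj q w) (v : V) : h.schur w v = 0 :=
  h.schur_eq_zero hr (by simp [h.schur_apply, G.adj_comm w, hp, hq]) v

lemma outer_not_adj (h : FarEdges G p x q y) (hr : graphRank G = 5) (hpw : ¬ G.Adj p w)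
    (hqw : ¬ G.Adj q w) (hpv : ¬ G.Adj p v) (hqv : ¬ G.Adj q v) : ¬ G.Adj w v := by
  simpa [h.schur_apply, G.adj_comm w p, G.adj_comm w q, hpw, hqw, hpv, hqv] using
    h.schur_outer hr hpw hqw v

lemma outer_adj_iff (h : FarEdges G p x q y) (hr : graphRank G = 5) (hpw : ¬ G.Adj p w)
    (hqw : ¬ G.Adj q w) (hu : G.Adj p u) : G.Adj w u ↔ G.Adj w x := by
  have h0 := h.schur_outer hr hpw hqw u
  simp only [h.schur_apply, SimpleGraph.adjMatrix_apply, G.adj_comm w p, G.adj_comm w q, hpw, hqw,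
    hu, h.common u hu, if_true, if_false] at h0
  revert h0
  by_cases h1 : G.Adj w u <;> by_cases h2 : G.Adj w x <;> simp [h1, h2]

lemma inner_adj_iff (h : FarEdges G p x q y) (hr : graphRank G = 5) (hu : G.Adj p u)
    (hv : G.Adj p v) : G.Adj u v ↔ ¬ (G.Adj x u ↔ G.Adj x v) := by
  have h0 := h.schur_sq hr u v
  rw [h.schur_self hu, h.schur_self hv] at h0
  simp only [h.schur_apply, SimpleGraph.adjMatrix_apply, G.adj_comm u p, G.adj_comm u q,
    G.adj_comm u x, hu, hv, h.common u hu, h.common v hv, if_true, if_false] at h0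
  revert h0
  by_cases h1 : G.Adj u v <;> by_cases h2 : G.Adj x u <;> by_cases h3 : G.Adj x v <;>
    norm_num [h1, h2, h3]

lemma cross_iff_or (h : FarEdges G p x q y) (hr : graphRank G = 5) (hu : G.Adj p u)
    (hv : G.Adj q v) (hx : ¬ G.Adj x u ∨ ¬ G.Adj y v) :
    (G.Adj u v ↔ G.Adj u y) ∧ (G.Adj x v ↔ G.Adj x y) ∨
      (G.Adj u v ↔ G.Adj x v) ∧ (G.Adj u y ↔ G.Adj x y) := by
  have h0 : h.schur u v ^ 2 = 0 := by
    rw [h.schur_sq hr, h.schur_self hu, h.schur_self' hv]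
    rcases hx with hx | hx <;> simp [hx]
  rw [h.schur_cross hu hv] at h0
  revert h0
  by_cases h1 : G.Adj x y <;> by_cases h2 : G.Adj x v <;> by_cases h3 : G.Adj u v <;>
    by_cases h4 : G.Adj u y <;> norm_num [h1, h2, h3, h4]

lemma cross_of_adj (h : FarEdges G p x q y) (hr : graphRank G = 5) (hu : G.Adj p u)
    (hv : G.Adj q v) (hxu : G.Adj x u) (hyv : G.Adj y v) :
    (G.Adj x y → G.Adj u v ∧ ¬ G.Adj x v ∧ ¬ G.Adj u y) ∧ (¬ G.Adj x y → G.Adj x v) := by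
  have h0 := h.schur_sq hr u v
  rw [h.schur_self hu, h.schur_self' hv, h.schur_cross hu hv] at h0
  revert h0
  by_cases h1 : G.Adj x y <;> by_cases h2 : G.Adj x v <;> by_cases h3 : G.Adj u v <;>
    by_cases h4 : G.Adj u y <;> norm_num [hxu, hyv, h1, h2, h3, h4]

lemma exists_inner_adj (h : FarEdges G p x q y) (hr : graphRank G = 5) :
    (∃ u, G.Adj p u ∧ G.Adj x u) ∨ ∃ v, G.Adj q v ∧ G.Adj y v := by
  obtain ⟨u, hu⟩ := h.exists_schur_ne_zero hr
  by_cases hp : G.Adj p u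
  · exact .inl ⟨u, hp, by_contra fun hx => hu (by simp [h.schur_self hp, hx])⟩
  by_cases hq : G.Adj q u
  · exact .inr ⟨u, hq, by_contra fun hy => hu (by simp [h.schur_self' hq, hy])⟩
  · exact absurd (h.schur_outer hr hp hq u) hu

end FarEdges

section Tripartite

variable {t a b c d l : ℝ}

lemma two_lt_of_tripartite (hb : 1 ≤ b) (hc : 1 ≤ c) (ht : 0 < t)
    (h : (b + c) * t + 2 * (b * c) < t * (t ^ 2 - b * c)) : 2 < t := by
  by_contra! h2
  have hp : 1 ≤ b * c := by nlinarith
  nlinarith [mul_nonneg (sub_nonneg.mpr h2) (sq_nonneg (t + 1)),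
    mul_nonneg ht.le (sub_nonneg.mpr hp)]

lemma tripartite_le (hb : 1 ≤ b) (hc : 1 ≤ c) (ht : 0 < t)
    (h : (b + c) * t + 2 * (b * c) < t * (t ^ 2 - b * c)) :
    2 * (t * (t ^ 2 - b * c)) ≤
      ((b + c) * t + 2 * (b * c)) * (t ^ 2 - t - 2 * (b + c - 2)) ∧
    (2 * (t * (t ^ 2 - b * c)) =
      ((b + c) * t + 2 * (b * c)) * (t ^ 2 - t - 2 * (b + c - 2)) → b = 1 ∧ c = 1) := by
  have := two_lt_of_tripartite hb hc ht h
  set e := (b - 1) * (c - 1) with he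
  have he0 : 0 ≤ e := mul_nonneg (by linarith) (by linarith)
  set w := t ^ 2 - t - 2 * (b + c - 1) with hw
  have : e * (t + 2) < (t + 1) * w := by
    rw [he, hw]; nlinarith
  have : e ≤ w := by
    by_contra! hlt
    nlinarith
  have hbr : 0 ≤ w + e * t - 2 * e := by nlinarith
  have : ((b + c) * t + 2 * (b * c)) * (t ^ 2 - t - 2 * (b + c - 2)) -
      2 * (t * (t ^ 2 - b * c)) = (b + c - 2) * ((t + 1) * w - e * (t + 2)) +
        (b + c - 2) * (w + e * t - 2 * e) + 2 * e * t ^ 2 := by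
    rw [he, hw]; ring
  have hs : 0 ≤ b + c - 2 := by linarith
  have h3 : 0 ≤ (b + c - 2) * ((t + 1) * w - e * (t + 2)) := mul_nonneg hs (by linarith)
  have h4 : 0 ≤ (b + c - 2) * (w + e * t - 2 * e) := mul_nonneg hs hbr
  have h5 : 0 ≤ 2 * e * t ^ 2 := by positivity
  refine ⟨by linarith, fun heq => ?_⟩
  have h6 : (b + c - 2) * ((t + 1) * w - e * (t + 2)) = 0 := by linarith
  have h7 : b + c - 2 = 0 := (mul_eq_zero.mp h6).resolve_right (by linarith)
  constructor <;> linarith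

variable {F : ℝ}

lemma two_mul_le_of_tripartite (hb : 1 ≤ b) (hc : 1 ≤ c) (ht : 0 < t)
    (hF : F = b / (t + b) + c / (t + c)) (h : F < t * (1 - F)) :
    2 * (t * (1 - F)) ≤ F * (t ^ 2 - t - 2 * (b + c - 2)) ∧
    (2 * (t * (1 - F)) = F * (t ^ 2 - t - 2 * (b + c - 2)) → b = 1 ∧ c = 1) := by
  have hm : 0 < (t + b) * (t + c) := by positivity
  have hF1 : F * ((t + b) * (t + c)) = (b + c) * t + 2 * (b * c) := by
    rw [hF]; field_simp; ring
  have hF2 : t * (1 - F) * ((t + b) * (t + c)) = t * (t ^ 2 - b * c) := by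
    linear_combination -t * hF1
  have key := tripartite_le hb hc ht (by rw [← hF1, ← hF2]; exact mul_lt_mul_of_pos_right h hm)
  rw [← hF1, ← hF2] at key
  refine ⟨le_of_mul_le_mul_right (by linarith [key.1]) hm, fun heq => key.2 ?_⟩
  linear_combination ((t + b) * (t + c)) * heq

variable {α β γ δ : ℝ}

lemma le_mul_of_tripartite (ha : 1 ≤ a) (hd : 1 ≤ d) (hl : 1 ≤ l) (hα : 0 < α) (hβ : 0 < β)
    (hγ : 0 < γ) (hδ : 0 < δ) (ht : 0 < t) (hF : F * (α + β + γ) ≤ β + γ)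
    (hA : a * (β + γ) + δ ≤ t * α) (hD : d * (β + γ) ≤ (t ^ 2 - d * (l + 1)) * δ) :
    0 < t * (1 - F) - a * F ∧ F ≤ (t ^ 2 - (d + l)) * (t * (1 - F) - a * F) ∧
    (F = (t ^ 2 - (d + l)) * (t * (1 - F) - a * F) →
      d = 1 ∧ F * (α + β + γ) = β + γ ∧ a * (β + γ) + δ = t * α) := by
  set s := α + β + γ
  set Q := t ^ 2 - (d + l) with hQ
  set Q' := t ^ 2 - d * (l + 1) with hQ'
  set M := t * (1 - F) - a * F
  have hs0 : 0 < s := by positivity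
  have hδM : 0 ≤ s * M - δ := by
    have := mul_nonneg (by linarith : 0 ≤ t + a) (sub_nonneg.mpr hF)
    linarith
  have hM0 : 0 < M := pos_of_mul_pos_right (by linarith : 0 < s * M) hs0.le
  have hQ'0 : 0 < Q' := pos_of_mul_pos_left (lt_of_lt_of_le (by positivity) hD) hδ.le
  have : 0 ≤ (d - 1) * (Q' + d * l) := mul_nonneg (by linarith) (by positivity)
  have h1 : 0 ≤ s * M * ((d - 1) * (Q' + d * l)) := by positivity
  have h2 : 0 ≤ Q' * (s * M - δ) := by positivity
  have h3 : 0 ≤ d * (β + γ - F * s) := mul_nonneg (by linarith) (by linarith)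
  have hsum : d * s * (Q * M - F) = s * M * ((d - 1) * (Q' + d * l)) + Q' * (s * M - δ) +
      (Q' * δ - d * (β + γ)) + d * (β + γ - F * s) := by
    rw [hQ, hQ']; ring
  have hds : 0 < d * s := by positivity
  refine ⟨hM0, sub_nonneg.mp (nonneg_of_mul_nonneg_right (by linarith) hds), fun heq => ?_⟩
  rw [sub_eq_zero.mpr heq.symm, mul_zero] at hsum
  have hd1 : s * M * ((d - 1) * (Q' + d * l)) = 0 := by linarith
  have hδ1 : Q' * (s * M - δ) = 0 := by linarith
  have hF1 : d * (β + γ - F * s) = 0 := by linarith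
  have hFs := (mul_eq_zero.mp hF1).resolve_left (by positivity)
  have hδs := (mul_eq_zero.mp hδ1).resolve_left hQ'0.ne'
  refine ⟨?_, by linarith, by linear_combination -hδs + (t + a) * hFs⟩
  have := (mul_eq_zero.mp ((mul_eq_zero.mp hd1).resolve_left (by positivity))).resolve_right
    (by positivity)
  linarith

/- Eliminating `β` and `γ` bounds `δ / (α + β + γ)` on both sides; the resulting inequality is
weakest for `b = c = d = 1`, the surplus being absorbed into `a` and `l`. -/
lemma secular_of_tripartite (ha : 1 ≤ a) (hb : 1 ≤ b) (hc : 1 ≤ c) (hd : 1 ≤ d) (hl : 1 ≤ l)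
    (ht : 0 < t) (hα : 0 < α) (hβ : 0 < β) (hγ : 0 < γ) (hδ : 0 < δ)
    (hA : a * (β + γ) + δ ≤ t * α) (hB : b * (α + γ) ≤ t * β) (hC : c * (α + β) ≤ t * γ)
    (hD : d * (β + γ) ≤ (t ^ 2 - d * (l + 1)) * δ) :
    0 < t ^ 2 - t - 2 * (a + b + c - 2) ∧
    2 ≤ (t ^ 2 - t - 2 * (a + b + c - 2)) * (t ^ 2 - (d + l)) ∧
    ((t ^ 2 - t - 2 * (a + b + c - 2)) * (t ^ 2 - (d + l)) = 2 → d = 1 ∧ b = 1 ∧ c = 1 ∧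
      a * (β + γ) + δ = t * α ∧ b * (α + γ) = t * β ∧ c * (α + β) = t * γ) := by
  obtain ⟨F, hF⟩ : ∃ F, F = b / (t + b) + c / (t + c) := ⟨_, rfl⟩
  have hF0 : 0 < F := by rw [hF]; positivity
  have hβ' : b / (t + b) * (α + β + γ) ≤ β := by
    rw [div_mul_eq_mul_div, div_le_iff₀ (by positivity)]; linarith
  have hγ' : c / (t + c) * (α + β + γ) ≤ γ := by
    rw [div_mul_eq_mul_div, div_le_iff₀ (by positivity)]; linarith
  obtain ⟨hM0, hQM, hQM_eq⟩ := le_mul_of_tripartite ha hd hl hα hβ hγ hδ ht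
    (by rw [hF]; linarith : F * (α + β + γ) ≤ β + γ) hA hD
  obtain ⟨hFP, hFP_eq⟩ := two_mul_le_of_tripartite hb hc ht hF (by nlinarith)
  set P := t ^ 2 - t - 2 * (a + b + c - 2) with hP
  set Q := t ^ 2 - (d + l)
  set M := t * (1 - F) - a * F with hM
  have : 0 ≤ F * P - 2 * M := by rw [hM, hP]; linarith
  have hP0 : 0 < P := pos_of_mul_pos_right (by linarith : 0 < F * P) hF0.le
  have hsum : M * (P * Q - 2) = P * (Q * M - F) + (F * P - 2 * M) := by ring
  have h0 : 0 ≤ P * (Q * M - F) := mul_nonneg hP0.le (sub_nonneg.mpr hQM)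
  refine ⟨hP0, sub_nonneg.mp (nonneg_of_mul_nonneg_right (by linarith) hM0), fun heq => ?_⟩
  rw [heq, sub_self, mul_zero] at hsum
  obtain ⟨hd1, hFs, hα1⟩ := hQM_eq <| (sub_eq_zero.mp
    ((mul_eq_zero.mp (by linarith : P * (Q * M - F) = 0)).resolve_left hP0.ne')).symm
  obtain ⟨hb1, hc1⟩ := hFP_eq (by linarith)
  rw [hF, add_mul] at hFs
  have hβ1 : b / (t + b) * (α + β + γ) = β := by linarith
  have hγ1 : c / (t + c) * (α + β + γ) = γ := by linarith
  rw [div_mul_eq_mul_div, div_eq_iff (by positivity)] at hβ1 hγ1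
  exact ⟨hd1, hb1, hc1, hα1, by linarith, by linarith⟩

end Tripartite

/-- The vertices of colours `0`, `1`, `2` span a complete tripartite graph, those of colours `3`,
`4` a complete bipartite graph; the vertices of colour `4` have no further neighbours, and the
vertex `r` of the tripartite part is joined to all vertices of colour `3`. Other edges between the
tripartite part and the colour `3` are allowed. -/
structure IsLinked {V : Type*} (G : SimpleGraph V) (κ : V → Fin 5) (r : V) : Prop where
  blob : ∀ u v, κ u < 3 → κ v < 3 → (G.Adj u v ↔ κ u ≠ κ v)
  leaf : ∀ u v, κ u = 4 → (G.Adj u v ↔ κ v = 3)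
  centre : ∀ u v, κ u = 3 → κ v = 3 → ¬ G.Adj u v
  root : κ r < 3
  link : ∀ v, κ v = 3 → G.Adj r v
  surj : ∀ i, ∃ v, κ v = i

namespace IsLinked

variable {V : Type*} {G : SimpleGraph V} {κ : V → Fin 5} {r : V}

lemma exists_root_eq_zero (h : IsLinked G κ r) : ∃ κ', IsLinked G κ' r ∧ κ' r = 0 := by
  obtain ⟨hlt, h3, h4⟩ : (∀ j, Equiv.swap 0 (κ r) j < 3 ↔ j < 3) ∧
      (∀ j, Equiv.swap 0 (κ r) j = 3 ↔ j = 3) ∧ ∀ j, Equiv.swap 0 (κ r) j = 4 ↔ j = 4 :=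
    (by decide : ∀ i : Fin 5, i < 3 → (∀ j, Equiv.swap 0 i j < 3 ↔ j < 3) ∧
      (∀ j, Equiv.swap 0 i j = 3 ↔ j = 3) ∧ ∀ j, Equiv.swap 0 i j = 4 ↔ j = 4) _ h.root
  refine ⟨Equiv.swap 0 (κ r) ∘ κ, ⟨fun u v hu hv => ?_, fun u v hu => ?_, fun u v hu hv => ?_,
    (hlt _).mpr h.root, fun v hv => h.link v ((h3 _).mp hv), ?_⟩, Equiv.swap_apply_right _ _⟩
  · rw [h.blob u v ((hlt _).mp hu) ((hlt _).mp hv)]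
    exact (Equiv.swap 0 (κ r)).injective.ne_iff.symm
  · exact (h.leaf u v ((h4 _).mp hu)).trans (h3 _).symm
  · exact h.centre u v ((h3 _).mp hu) ((h3 _).mp hv)
  · exact (Equiv.swap 0 (κ r)).surjective.comp h.surj

/-- The vertex of `G10` to which `IsLinked.nonempty_iso` sends a vertex: the root is split off from
its colour class. -/
noncomputable def G10Colour (κ : V → Fin 5) (r v : V) : Fin 6 :=
  if v = r then 0 else (![4, 1, 2, 3, 5] : Fin 5 → Fin 6) (κ v)

lemma G10Colour_cases (hr : κ r = 0) (v : V) :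
    (v = r ∧ κ v = 0 ∧ G10Colour κ r v = 0) ∨ (v ≠ r ∧ κ v = 0 ∧ G10Colour κ r v = 4) ∨
    (v ≠ r ∧ κ v = 1 ∧ G10Colour κ r v = 1) ∨ (v ≠ r ∧ κ v = 2 ∧ G10Colour κ r v = 2) ∨
    (v ≠ r ∧ κ v = 3 ∧ G10Colour κ r v = 3) ∨ (v ≠ r ∧ κ v = 4 ∧ G10Colour κ r v = 5) := by
  by_cases hv : v = r
  · exact Or.inl ⟨hv, hv ▸ hr, if_pos hv⟩
  · simp only [G10Colour, hv, if_false, ne_eq, not_false_eq_true, true_and, false_and, false_or]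
    exact (by decide : ∀ i : Fin 5, (i = 0 ∧ (![4, 1, 2, 3, 5] : Fin 5 → Fin 6) i = 4) ∨
      (i = 1 ∧ (![4, 1, 2, 3, 5] : Fin 5 → Fin 6) i = 1) ∨
      (i = 2 ∧ (![4, 1, 2, 3, 5] : Fin 5 → Fin 6) i = 2) ∨
      (i = 3 ∧ (![4, 1, 2, 3, 5] : Fin 5 → Fin 6) i = 3) ∨
      (i = 4 ∧ (![4, 1, 2, 3, 5] : Fin 5 → Fin 6) i = 5)) (κ v)

lemma eq_comap_G10 (h : IsLinked G κ r) (hr : κ r = 0)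
    (hlink : ∀ u v, κ u < 3 → κ v = 3 → (G.Adj u v ↔ u = r)) :
    G = G10.comap (G10Colour κ r) := by
  ext u v
  rw [SimpleGraph.comap_adj, G10_adj_iff]
  have := h.blob u v
  have := h.leaf u v
  have := h.leaf v u
  have := h.centre u v
  have := hlink u v
  have := hlink v u
  rw [G.adj_comm v u] at *
  rcases G10Colour_cases hr u with ⟨_, _, _⟩ | ⟨_, _, _⟩ | ⟨_, _, _⟩ |
    ⟨_, _, _⟩ | ⟨_, _, _⟩ | ⟨_, _, _⟩ <;>
  rcases G10Colour_cases hr v with ⟨_, _, _⟩ | ⟨_, _, _⟩ | ⟨_, _, _⟩ |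
    ⟨_, _, _⟩ | ⟨_, _, _⟩ | ⟨_, _, _⟩ <;>
  simp_all (decide := true)

variable [Fintype V]

lemma colourClass_nonempty (h : IsLinked G κ r) (i : Fin 5) : (colourClass κ i).Nonempty :=
  (h.surj i).imp fun _ => mem_colourClass.mpr

lemma one_le_card (h : IsLinked G κ r) (i : Fin 5) : (1 : ℝ) ≤ (colourClass κ i).card :=
  Nat.one_le_cast.mpr (Finset.card_pos.mpr (h.colourClass_nonempty i))

section Perron

variable {t : ℝ} {x : V → ℝ}

lemma card_mul_sum_add_le (h : IsLinked G κ r) (hx : IsPerron G t x) {i j k : Fin 5}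
    (hi : i < 3) (hj : j < 3) (hk : k < 3) (hij : i ≠ j) (hik : i ≠ k) (hjk : j ≠ k) :
    (colourClass κ i).card * (∑ v ∈ colourClass κ j, x v + ∑ v ∈ colourClass κ k, x v) +
      ∑ u ∈ colourClass κ i, ∑ v ∈ colourClass κ 3 with G.Adj u v, x v ≤
        t * ∑ v ∈ colourClass κ i, x v := by
  rw [← Finset.sum_union (disjoint_colourClass hjk)]
  refine hx.card_mul_sum_add_le (fun u hu v hv => ?_) (fun u _ v hv => (Finset.mem_filter.mp hv).2)
    fun u _ => Disjoint.mono_right (Finset.filter_subset _ _) (Finset.disjoint_union_left.mpr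
      ⟨disjoint_colourClass (by grind), disjoint_colourClass (by grind)⟩)
  simp only [Finset.mem_union, mem_colourClass] at hu hv
  exact (h.blob u v (by grind) (by grind)).mpr (by grind)

lemma card_mul_sum_le (h : IsLinked G κ r) (hr : κ r = 0) (hx : IsPerron G t x) :
    (colourClass κ 3).card * (∑ v ∈ colourClass κ 1, x v + ∑ v ∈ colourClass κ 2, x v) ≤
      (t ^ 2 - (colourClass κ 3).card * ((colourClass κ 4).card + 1)) *
        ∑ v ∈ colourClass κ 3, x v := by
  have ht : 0 ≤ t := have : Nonempty V := ⟨r⟩; hx.nonneg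
  have hleaf := hx.card_mul_sum_le (I := colourClass κ 4) (T := colourClass κ 3) fun u hu v hv =>
    (h.leaf u v (mem_colourClass.mp hu)).mpr (mem_colourClass.mp hv)
  have hcentre := hx.card_mul_sum_le (I := colourClass κ 3) (T := insert r (colourClass κ 4))
    fun u hu v hv => by
      rw [mem_colourClass] at hu
      rcases Finset.mem_insert.mp hv with rfl | hv
      · exact (h.link u hu).symm
      · exact ((h.leaf v u (mem_colourClass.mp hv)).mpr hu).symm
  rw [Finset.sum_insert (by simp [mem_colourClass, hr])] at hcentre
  have hroot := hx.sum_le_mul (u := r)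
    (T := colourClass κ 1 ∪ colourClass κ 2 ∪ colourClass κ 3) fun v hv => by
      simp only [Finset.mem_union, mem_colourClass] at hv
      rcases hv with hv | hv
      · exact (h.blob r v h.root (by grind)).mpr (by grind)
      · exact h.link v hv
  rw [Finset.sum_union (Finset.disjoint_union_left.mpr ⟨disjoint_colourClass (by decide),
    disjoint_colourClass (by decide)⟩), Finset.sum_union (disjoint_colourClass (by decide))]
    at hroot
  have hd : (0 : ℝ) ≤ (colourClass κ 3).card := Nat.cast_nonneg _
  linarith [mul_le_mul_of_nonneg_left hcentre ht, mul_le_mul_of_nonneg_left hroot hd,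
    mul_le_mul_of_nonneg_left hleaf hd]

lemma sum_link_root (h : IsLinked G κ r) :
    ∑ v ∈ colourClass κ 3 with G.Adj r v, x v = ∑ v ∈ colourClass κ 3, x v := by
  rw [Finset.filter_true_of_mem fun v hv => h.link v (mem_colourClass.mp hv)]

lemma eq_root_of_adj (h : IsLinked G κ r) (hr : κ r = 0) (hx : IsPerron G t x)
    (h0 : ∑ u ∈ colourClass κ 0, ∑ v ∈ colourClass κ 3 with G.Adj u v, x v ≤
      ∑ v ∈ colourClass κ 3, x v)
    (h12 : ∀ i, i = 1 ∨ i = 2 →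
      ∑ u ∈ colourClass κ i, ∑ v ∈ colourClass κ 3 with G.Adj u v, x v ≤ 0)
    {u v : V} (hu : κ u < 3) (hv : κ v = 3) (huv : G.Adj u v) : u = r := by
  by_contra hur
  have hpos : 0 < ∑ v ∈ colourClass κ 3 with G.Adj u v, x v :=
    hx.sum_pos ⟨v, Finset.mem_filter.mpr ⟨mem_colourClass.mpr hv, huv⟩⟩
  have hnonneg (w : V) : 0 ≤ ∑ v ∈ colourClass κ 3 with G.Adj w v, x v := hx.sum_nonneg _
  by_cases hu0 : κ u = 0
  · have := Finset.add_le_sum (fun w _ => hnonneg w) (mem_colourClass.mpr hu0)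
      (mem_colourClass.mpr hr) hur
    rw [h.sum_link_root] at this
    linarith
  · have := Finset.single_le_sum (fun w _ => hnonneg w) (mem_colourClass.mpr (rfl : κ u = κ u))
    linarith [h12 (κ u) (by grind)]

lemma secular (h : IsLinked G κ r) (hr : κ r = 0) (hx : IsPerron G t x) {m s : ℕ}
    (hm : (colourClass κ 0).card + (colourClass κ 1).card + (colourClass κ 2).card = m + 2)
    (hs : (colourClass κ 3).card + (colourClass κ 4).card = s) :
    0 < t ∧ 0 < t ^ 2 - t - 2 * (m : ℝ) ∧ 2 ≤ (t ^ 2 - t - 2 * (m : ℝ)) * (t ^ 2 - s) ∧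
    ((t ^ 2 - t - 2 * (m : ℝ)) * (t ^ 2 - s) = 2 → (colourClass κ 3).card = 1 ∧
      (colourClass κ 1).card = 1 ∧ (colourClass κ 2).card = 1 ∧
      ∀ u v, κ u < 3 → κ v = 3 → (G.Adj u v ↔ u = r)) := by
  have hm' : (m : ℝ) = (colourClass κ 0).card + (colourClass κ 1).card +
      (colourClass κ 2).card - 2 := by
    rw [eq_sub_iff_add_eq]; exact_mod_cast hm.symm
  have hs' : (s : ℝ) = (colourClass κ 3).card + (colourClass κ 4).card := by exact_mod_cast hs.symm
  have hpos (i : Fin 5) : 0 < ∑ v ∈ colourClass κ i, x v := hx.sum_pos (h.colourClass_nonempty i)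
  have hnonneg (i : Fin 5) :
      0 ≤ ∑ u ∈ colourClass κ i, ∑ v ∈ colourClass κ 3 with G.Adj u v, x v :=
    Finset.sum_nonneg fun u _ => hx.sum_nonneg _
  have h0 := h.card_mul_sum_add_le hx (i := 0) (j := 1) (k := 2) (by decide) (by decide)
    (by decide) (by decide) (by decide) (by decide)
  have h1 := h.card_mul_sum_add_le hx (i := 1) (j := 0) (k := 2) (by decide) (by decide)
    (by decide) (by decide) (by decide) (by decide)
  have h2 := h.card_mul_sum_add_le hx (i := 2) (j := 0) (k := 1) (by decide) (by decide)
    (by decide) (by decide) (by decide) (by decide)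
  have hroot : ∑ v ∈ colourClass κ 3, x v ≤
      ∑ u ∈ colourClass κ 0, ∑ v ∈ colourClass κ 3 with G.Adj u v, x v :=
    h.sum_link_root.symm.trans_le <| Finset.single_le_sum
      (f := fun u => ∑ v ∈ colourClass κ 3 with G.Adj u v, x v) (fun u _ => hx.sum_nonneg _)
      (mem_colourClass.mpr hr)
  have ht : 0 < t := by
    refine pos_of_mul_pos_left ((hpos 3).trans_le ?_) (hpos 0).le
    nlinarith [h.one_le_card 0, hpos 1, hpos 2]
  obtain ⟨hP, hPQ, hPQ_eq⟩ := secular_of_tripartite (h.one_le_card 0) (h.one_le_card 1)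
    (h.one_le_card 2) (h.one_le_card 3) (h.one_le_card 4) ht (hpos 0) (hpos 1) (hpos 2) (hpos 3)
    (by linarith) (by linarith [hnonneg 1]) (by linarith [hnonneg 2]) (h.card_mul_sum_le hr hx)
  rw [← hm'] at hP hPQ hPQ_eq
  rw [← hs'] at hPQ hPQ_eq
  refine ⟨ht, hP, hPQ, fun heq => ?_⟩
  obtain ⟨hd, hb, hc, e0, e1, e2⟩ := hPQ_eq heq
  refine ⟨mod_cast hd, mod_cast hb, mod_cast hc, fun u v hu hv =>
    ⟨h.eq_root_of_adj hr hx (by linarith) ?_ hu hv, fun hur => hur ▸ h.link v hv⟩⟩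
  rintro i (rfl | rfl) <;> linarith

end Perron

lemma card_colourClass_G10Colour (hr : κ r = 0) (hb : (colourClass κ 1).card = 1)
    (hc : (colourClass κ 2).card = 1) (hd : (colourClass κ 3).card = 1) (i : Fin 6) :
    (colourClass (G10Colour κ r) i).card =
      (![1, 1, 1, 1, (colourClass κ 0).card - 1, (colourClass κ 4).card] : Fin 6 → ℕ) i := by
  have h0 : colourClass (G10Colour κ r) 0 = {r} := by
    ext v; rw [mem_colourClass, Finset.mem_singleton]; grind [G10Colour_cases hr v]
  have h4 : colourClass (G10Colour κ r) 4 = (colourClass κ 0).erase r := by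
    ext v; rw [mem_colourClass, Finset.mem_erase, mem_colourClass]; grind [G10Colour_cases hr v]
  have h {i : Fin 6} {j : Fin 5} (hij : i = 1 ∧ j = 1 ∨ i = 2 ∧ j = 2 ∨ i = 3 ∧ j = 3 ∨
      i = 5 ∧ j = 4) : colourClass (G10Colour κ r) i = colourClass κ j := by
    ext v; rw [mem_colourClass, mem_colourClass]; grind [G10Colour_cases hr v]
  fin_cases i
  · exact h0 ▸ Finset.card_singleton r
  · exact (congrArg _ (h (by decide))).trans hb
  · exact (congrArg _ (h (by decide))).trans hc
  · exact (congrArg _ (h (by decide))).trans hd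
  · exact h4 ▸ Finset.card_erase_of_mem (mem_colourClass.mpr hr)
  · exact congrArg _ (h (by decide))

lemma nonempty_iso (h : IsLinked G κ r) (hr : κ r = 0) (hb : (colourClass κ 1).card = 1)
    (hc : (colourClass κ 2).card = 1) (hd : (colourClass κ 3).card = 1)
    (hlink : ∀ u v, κ u < 3 → κ v = 3 → (G.Adj u v ↔ u = r)) :
    Nonempty (G ≃g
      blowup G10 ![1, 1, 1, 1, (colourClass κ 0).card - 1, (colourClass κ 4).card]) :=
  nonempty_iso_blowup (G10Colour κ r) (card_colourClass_G10Colour hr hb hc hd)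
    (h.eq_comap_G10 hr hlink)

end IsLinked

section Walks

/-- The number of walks of length two from a vertex of class `k` to a vertex whose class lies in
`S`, in the graph with `n i` vertices of each class `i` and adjacency between classes given by
`N`. -/
def classWalks {ι : Type*} [DecidableEq ι] (N : ι → Finset ι) (n : ι → ℕ) (S : Finset ι) (k : ι) :
    ℕ :=
  ∑ j ∈ N k, n j * ∑ i ∈ S ∩ N j, n i

lemma sum_mul_sum_comm_of_symm {ι : Type*} [Fintype ι] [DecidableEq ι] {N : ι → Finset ι}
    (hN : ∀ i j, j ∈ N i ↔ i ∈ N j) (S : Finset ι) (f g : ι → ℝ) :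
    ∑ k ∈ S, f k * ∑ j ∈ N k, g j = ∑ j, g j * ∑ k ∈ S ∩ N j, f k := by
  simp only [Finset.mul_sum]
  rw [Finset.sum_comm' (t' := Finset.univ) (s' := fun j => S ∩ N j) (by simp [hN])]
  exact Finset.sum_congr rfl fun j _ => Finset.sum_congr rfl fun k _ => mul_comm _ _

variable {V ι : Type*} [Fintype V] {G : SimpleGraph V} {t : ℝ} {x : V → ℝ} {κ : V → ι}
  {N : ι → Finset ι}

lemma IsPerron.card_colourClass_mul_sum_le (hx : IsPerron G t x)
    (hG : ∀ u v, κ v ∈ N (κ u) → G.Adj u v) (i : ι) :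
    (colourClass κ i).card * ∑ j ∈ N i, ∑ v ∈ colourClass κ j, x v ≤
      t * ∑ v ∈ colourClass κ i, x v := by
  rw [← Finset.sum_biUnion fun i _ j _ hij => disjoint_colourClass hij]
  refine hx.card_mul_sum_le fun u hu v hv => hG u v ?_
  obtain ⟨j, hj, hv⟩ := Finset.mem_biUnion.mp hv
  rwa [mem_colourClass.mp hu, mem_colourClass.mp hv]

-- Two steps of the adjacency matrix, restricted to walks that start and end in `S`, applied to the
-- total weights of the colour classes.
lemma IsPerron.exists_classWalks_le_sq [Finite ι] [DecidableEq ι] (hx : IsPerron G t x)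
    (hN : ∀ i j, j ∈ N i ↔ i ∈ N j) (hG : ∀ u v, κ v ∈ N (κ u) → G.Adj u v) {S : Finset ι}
    (hS : ∃ v, κ v ∈ S) :
    ∃ k ∈ S, (classWalks N (fun i => (colourClass κ i).card) S k : ℝ) ≤ t ^ 2 := by
  cases nonempty_fintype ι
  obtain ⟨v₀, hv₀⟩ := hS
  have : Nonempty V := ⟨v₀⟩
  obtain ⟨k₀, hk₀, hmin⟩ := S.exists_min_image
    (classWalks N (fun i => (colourClass κ i).card) S) ⟨_, hv₀⟩
  refine ⟨k₀, hk₀, ?_⟩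
  generalize classWalks N (fun i => (colourClass κ i).card) S k₀ = q at hmin ⊢
  set X : ι → ℝ := fun i => ∑ v ∈ colourClass κ i, x v
  set n : ι → ℝ := fun i => (colourClass κ i).card
  have hXn (i : ι) : 0 ≤ X i := hx.sum_nonneg _
  have hstep (i : ι) : n i * ∑ j ∈ N i, X j ≤ t * X i := hx.card_colourClass_mul_sum_le hG i
  have hpos : 0 < ∑ i ∈ S, X i := Finset.sum_pos' (fun i _ => hXn i)
    ⟨κ v₀, hv₀, hx.sum_pos ⟨v₀, mem_colourClass.mpr rfl⟩⟩
  refine le_of_mul_le_mul_right ?_ hpos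
  calc q * ∑ k ∈ S, X k
      ≤ ∑ k ∈ S, X k * ∑ j ∈ N k, n j * ∑ i ∈ S ∩ N j, n i := by
        rw [Finset.mul_sum]
        refine Finset.sum_le_sum fun k hk => ?_
        rw [mul_comm]
        exact mul_le_mul_of_nonneg_left (by simp only [n]; exact_mod_cast hmin k hk) (hXn k)
    _ = ∑ i ∈ S, n i * ∑ j ∈ N i, n j * ∑ k ∈ S ∩ N j, X k := by
        rw [sum_mul_sum_comm_of_symm hN, sum_mul_sum_comm_of_symm hN]
        exact Finset.sum_congr rfl fun j _ => mul_right_comm _ _ _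
    _ ≤ ∑ i ∈ S, n i * ∑ j ∈ N i, t * X j := by
        refine Finset.sum_le_sum fun i _ => mul_le_mul_of_nonneg_left
          (Finset.sum_le_sum fun j _ => ?_) (Nat.cast_nonneg _)
        refine (mul_le_mul_of_nonneg_left ?_ (Nat.cast_nonneg _)).trans (hstep j)
        exact Finset.sum_le_sum_of_subset_of_nonneg Finset.inter_subset_right fun k _ _ => hXn k
    _ ≤ ∑ i ∈ S, t * (t * X i) := by
        refine Finset.sum_le_sum fun i _ => ?_
        rw [← Finset.mul_sum, mul_left_comm]
        exact mul_le_mul_of_nonneg_left (hstep i) hx.nonneg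
    _ = t ^ 2 * ∑ i ∈ S, X i := by rw [← Finset.mul_sum, ← Finset.mul_sum]; ring

/-- The number of walks of length two starting at `v`. -/
noncomputable def twoWalks (G : SimpleGraph V) (v : V) : ℕ :=
  ∑ u ∈ G.neighborFinset v, G.degree u

lemma sum_twoWalks (G : SimpleGraph V) : ∑ v, twoWalks G v = ∑ v, G.degree v ^ 2 := by
  simp only [twoWalks]
  rw [Finset.sum_comm' (t' := Finset.univ) (s' := fun v => G.neighborFinset v)
    (by simp [SimpleGraph.adj_comm])]
  simp [sq]

lemma even_sum_twoWalks (G : SimpleGraph V) : Even (∑ v, twoWalks G v) := by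
  have hsum : Even (∑ v, G.degree v) := G.sum_degrees_eq_twice_card_edges ▸ even_two_mul _
  rw [sum_twoWalks, Finset.even_sum_iff_even_card_odd] at *
  simpa only [Nat.odd_pow_iff two_ne_zero] using hsum

lemma IsPerron.sum_twoWalks_le (hx : IsPerron G t x) :
    ((∑ v, twoWalks G v : ℕ) : ℝ) ≤ t ^ 2 * Fintype.card V := by
  have hA : (G.adjMatrix ℝ * G.adjMatrix ℝ) *ᵥ x = t ^ 2 • x := by
    rw [← mulVec_mulVec, hx.eq, mulVec_smul, hx.eq, smul_smul, sq]
  have hsymm : (G.adjMatrix ℝ * G.adjMatrix ℝ).IsSymm := by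
    rw [IsSymm, transpose_mul, SimpleGraph.transpose_adjMatrix]
  have h := dotProduct_mulVec_le_of_pos_eigenvector hsymm (fun i j => Finset.sum_nonneg fun k _ =>
    mul_nonneg (adjMatrix_nonneg G i k) (adjMatrix_nonneg G k j)) hx.pos hA fun _ => 1
  rw [← mulVec_mulVec, dotProduct_mulVec, ← mulVec_transpose, SimpleGraph.transpose_adjMatrix] at h
  rw [sum_twoWalks]
  simpa [dotProduct, SimpleGraph.adjMatrix_mulVec_apply, sq] using h

lemma card_le_twoWalks (hdiam : ∀ u v, u ≠ v → ¬ G.Adj u v → ∃ w, G.Adj u w ∧ G.Adj v w) (v : V) :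
    Fintype.card V ≤ twoWalks G v + 1 := by
  have hcover : Finset.univ.erase v ⊆
      (G.neighborFinset v).biUnion fun u => insert u ((G.neighborFinset u).erase v) := by
    intro w hw
    have hwv := (Finset.mem_erase.mp hw).1
    by_cases hvw : G.Adj v w
    · exact Finset.mem_biUnion.mpr ⟨w, by simpa using hvw, Finset.mem_insert_self _ _⟩
    · obtain ⟨u, hvu, hwu⟩ := hdiam v w hwv.symm hvw
      exact Finset.mem_biUnion.mpr ⟨u, by simpa using hvu, by simp [hwv, hwu.symm]⟩
  have hcard (u : V) (hu : u ∈ G.neighborFinset v) :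
      (insert u ((G.neighborFinset u).erase v)).card ≤ G.degree u := by
    refine (Finset.card_insert_le _ _).trans_eq ?_
    rw [Finset.card_erase_add_one (by simpa [SimpleGraph.adj_comm] using hu),
      SimpleGraph.card_neighborFinset_eq_degree]
  rw [← Finset.card_univ, ← Nat.sub_le_iff_le_add, ← Finset.card_erase_of_mem (Finset.mem_univ v)]
  exact (Finset.card_le_card hcover).trans (Finset.card_biUnion_le.trans (Finset.sum_le_sum hcard))

end Walks

section SmallOrder

lemma nonempty_iso_cycleGraph {V : Type*} {G : SimpleGraph V} {k : ℕ}
    {g : Fin (k + 2) → V} (hg : Function.Bijective g)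
    (h : ∀ i z, G.Adj (g i) z ↔ z = g (i - 1) ∨ z = g (i + 1)) :
    Nonempty (G ≃g SimpleGraph.cycleGraph (k + 2)) := by
  refine ⟨SimpleGraph.Iso.symm ⟨Equiv.ofBijective g hg, fun {i j} => ?_⟩⟩
  rw [Equiv.ofBijective_apply, Equiv.ofBijective_apply, h, hg.injective.eq_iff, hg.injective.eq_iff,
    SimpleGraph.cycleGraph_adj]
  grind

variable {V : Type*} [Fintype V] {G : SimpleGraph V}

lemma exists_adj_iff_of_degree_eq_two {u v : V} (h2 : G.degree v = 2) (hu : G.Adj v u) :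
    ∃ w, w ≠ u ∧ ∀ z, G.Adj v z ↔ z = u ∨ z = w := by
  obtain ⟨a, b, hab, hN⟩ := Finset.card_eq_two.mp h2
  have hz (z : V) : G.Adj v z ↔ z = a ∨ z = b := by
    rw [← SimpleGraph.mem_neighborFinset, hN, Finset.mem_insert, Finset.mem_singleton]
  rcases (hz u).mp hu with rfl | rfl
  · exact ⟨b, hab.symm, hz⟩
  · exact ⟨a, hab, fun z => (hz z).trans or_comm⟩

lemma nonempty_iso_cycleGraph_five (hn : Fintype.card V = 5) (hdeg : ∀ v, G.degree v = 2)
    (hdiam : ∀ u v, u ≠ v → ¬ G.Adj u v → ∃ w, G.Adj u w ∧ G.Adj v w) :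
    Nonempty (G ≃g SimpleGraph.cycleGraph 5) := by
  obtain ⟨v₀⟩ : Nonempty V := Fintype.card_pos_iff.mp (by omega)
  obtain ⟨a, ha⟩ := (G.degree_pos_iff_exists_adj v₀).mp (by rw [hdeg]; exact two_pos)
  obtain ⟨b, -, h₀⟩ := exists_adj_iff_of_degree_eq_two (hdeg v₀) ha
  have hb : G.Adj v₀ b := (h₀ b).mpr (Or.inr rfl)
  obtain ⟨c, -, h₁⟩ := exists_adj_iff_of_degree_eq_two (hdeg a) ha.symm
  obtain ⟨d, -, h₄⟩ := exists_adj_iff_of_degree_eq_two (hdeg b) hb.symm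
  have hcover (w : V) : w = v₀ ∨ w = a ∨ w = b ∨ w = c ∨ w = d := by
    by_cases hw₀ : w = v₀
    · exact Or.inl hw₀
    by_cases hw : G.Adj v₀ w
    · grind
    · obtain ⟨z, hz, hwz⟩ := hdiam v₀ w (Ne.symm hw₀) hw
      grind [G.adj_comm w z]
  have hg : Function.Bijective ![v₀, a, c, d, b] := by
    refine (Fintype.bijective_iff_surjective_and_card _).mpr ⟨fun w => ?_, by simp [hn]⟩
    rcases hcover w with rfl | rfl | rfl | rfl | rfl
    exacts [⟨0, rfl⟩, ⟨1, rfl⟩, ⟨4, rfl⟩, ⟨2, rfl⟩, ⟨3, rfl⟩]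
  have hcb : c ≠ b := hg.injective.ne (by decide : (2 : Fin 5) ≠ 4)
  have hcv : c ≠ v₀ := hg.injective.ne (by decide : (2 : Fin 5) ≠ 0)
  have hcd : c ≠ d := hg.injective.ne (by decide : (2 : Fin 5) ≠ 3)
  have hac : G.Adj a c := (h₁ c).mpr (Or.inr rfl)
  have hbd : G.Adj b d := (h₄ d).mpr (Or.inr rfl)
  obtain ⟨e, hea, h₂⟩ := exists_adj_iff_of_degree_eq_two (hdeg c) hac.symm
  obtain ⟨f, -, h₃⟩ := exists_adj_iff_of_degree_eq_two (hdeg d) hbd.symm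
  have hce : G.Adj c e := (h₂ e).mpr (Or.inr rfl)
  obtain rfl : e = d := by
    have := hcover e
    grind [G.adj_comm c e, hac.ne, hce.ne]
  obtain rfl : f = c := ((h₃ c).mp hce.symm).resolve_left hcb |>.symm
  refine nonempty_iso_cycleGraph hg fun i z => ?_
  fin_cases i
  exacts [(h₀ z).trans or_comm, h₁ z, h₂ z, (h₃ z).trans or_comm, (h₄ z).trans or_comm]

lemma graphRank_le_two_of_twoWalks {q : V} (hq : G.degree q = 1)
    (hw : ∀ v, twoWalks G v + 1 = Fintype.card V) : graphRank G ≤ 2 := by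
  obtain ⟨p, hp⟩ := Finset.card_eq_one.mp hq
  have hpd : G.degree p + 1 = Fintype.card V := by
    have := hw q
    rwa [twoWalks, hp, Finset.sum_singleton] at this
  have hN : insert p (G.neighborFinset p) = Finset.univ := by
    rw [← Finset.card_eq_iff_eq_univ, Finset.card_insert_of_notMem (by simp),
      SimpleGraph.card_neighborFinset_eq_degree, hpd]
  have hp_adj (v : V) (hv : v ≠ p) : G.Adj p v := by
    have := hN ▸ Finset.mem_univ v
    simpa [hv] using this
  have hle : ∀ u ∈ G.neighborFinset p, 1 ≤ G.degree u := fun u hu =>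
    (G.degree_pos_iff_exists_adj u).mpr ⟨p, ((G.mem_neighborFinset p u).mp hu).symm⟩
  have hdeg (u : V) (hu : u ≠ p) : G.neighborFinset u = {p} := by
    have hp_mem := (G.mem_neighborFinset p u).mpr (hp_adj u hu)
    have hone := (Finset.sum_eq_sum_iff_of_le hle).mp (by
      rw [← Finset.card_eq_sum_ones, SimpleGraph.card_neighborFinset_eq_degree]
      exact (Nat.succ_injective ((hw p).trans hpd.symm)).symm) u hp_mem
    obtain ⟨w, hw⟩ := Finset.card_eq_one.mp hone.symm
    have := (G.mem_neighborFinset u p).mpr (hp_adj u hu).symm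
    rw [hw, Finset.mem_singleton] at this
    rw [hw, this]
  have hstar : G = (⊤ : SimpleGraph Prop).comap (· = p) := by
    ext u v
    rw [SimpleGraph.comap_adj, SimpleGraph.top_adj]
    by_cases hu : u = p
    · subst hu
      by_cases hv : v = u <;> simp [hv, hp_adj]
    · rw [← SimpleGraph.mem_neighborFinset, hdeg u hu, Finset.mem_singleton]
      simp [hu]
  rw [hstar]
  exact (graphRank_comap_le _ _).trans (graphRank_le_card _)

lemma degree_eq_two_of_twoWalks (hn : Fintype.card V = 5 ∨ Fintype.card V = 6)
    (hG : G.Connected) (hr : 2 < graphRank G)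
    (hw : ∀ v, twoWalks G v + 1 = Fintype.card V) :
    Fintype.card V = 5 ∧ ∀ v, G.degree v = 2 := by
  have : Nontrivial V := Fintype.one_lt_card_iff_nontrivial.mp (by omega)
  have h2 (v : V) : 2 ≤ G.degree v :=
    Nat.lt_of_le_of_ne (hG.preconnected.degree_pos_of_nontrivial v) fun h =>
      hr.not_ge (graphRank_le_two_of_twoWalks h.symm hw)
  have hle (v : V) : G.degree v * 2 ≤ twoWalks G v :=
    Finset.card_nsmul_le_sum _ _ _ fun u _ => h2 u
  have hdeg (v : V) : G.degree v = 2 := by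
    have := h2 v
    have := hle v
    have := hw v
    omega
  refine ⟨?_, hdeg⟩
  obtain ⟨v⟩ := hG.nonempty
  rw [← hw v, twoWalks, Finset.sum_congr rfl fun u _ => hdeg u, Finset.sum_const,
    SimpleGraph.card_neighborFinset_eq_degree, hdeg v, smul_eq_mul]

variable {t : ℝ} {x : V → ℝ}

lemma le_sq_of_diam_two (hx : IsPerron G t x) (hG : G.Connected)
    (hdiam : ∀ u v, u ≠ v → ¬ G.Adj u v → ∃ w, G.Adj u w ∧ G.Adj v w) :
    (Fintype.card V : ℝ) - 1 ≤ t ^ 2 := by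
  have := hG.nonempty
  have hcard : (Fintype.card V : ℝ) * Fintype.card V ≤
      ((∑ v, twoWalks G v : ℕ) : ℝ) + Fintype.card V := by
    have := Finset.sum_le_sum fun v (_ : v ∈ Finset.univ) => card_le_twoWalks hdiam v
    rw [Finset.sum_add_distrib, Finset.sum_const, Finset.sum_const, Finset.card_univ, smul_eq_mul,
      smul_eq_mul, mul_one] at this
    exact_mod_cast this
  have hpos : (0 : ℝ) < Fintype.card V := Nat.cast_pos.mpr Fintype.card_pos
  refine le_of_mul_le_mul_right ?_ hpos
  linarith [hx.sum_twoWalks_le]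

lemma degree_eq_two_of_sum_twoWalks_le (hn : Fintype.card V = 5 ∨ Fintype.card V = 6)
    (hG : G.Connected) (hr : 2 < graphRank G)
    (hdiam : ∀ u v, u ≠ v → ¬ G.Adj u v → ∃ w, G.Adj u w ∧ G.Adj v w)
    (hw : ∑ v, twoWalks G v + Fintype.card V ≤ Fintype.card V * Fintype.card V) :
    Fintype.card V = 5 ∧ ∀ v, G.degree v = 2 := by
  refine degree_eq_two_of_twoWalks hn hG hr fun v => ?_
  have hle : ∀ v ∈ Finset.univ, Fintype.card V ≤ twoWalks G v + 1 :=
    fun v _ => card_le_twoWalks hdiam v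
  refine ((Finset.sum_eq_sum_iff_of_le hle).mp (le_antisymm (Finset.sum_le_sum hle) ?_) v
    (Finset.mem_univ v)).symm
  simpa [Finset.sum_add_distrib] using hw

lemma le_sq_of_card_six (hx : IsPerron G t x) (hG : G.Connected)
    (hr : 2 < graphRank G) (hn : Fintype.card V = 6)
    (hdiam : ∀ u v, u ≠ v → ¬ G.Adj u v → ∃ w, G.Adj u w ∧ G.Adj v w) : 16 / 3 ≤ t ^ 2 := by
  have hle := hx.sum_twoWalks_le
  have h31 : 31 ≤ ∑ v, twoWalks G v := by
    by_contra! h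
    have := degree_eq_two_of_sum_twoWalks_le (Or.inr hn) hG hr hdiam (by rw [hn]; omega)
    omega
  have h32 : 32 ≤ ∑ v, twoWalks G v := by
    obtain ⟨k, hk⟩ := even_sum_twoWalks G
    omega
  have : (32 : ℝ) ≤ ((∑ v, twoWalks G v : ℕ) : ℝ) := mod_cast h32
  rw [hn, Nat.cast_ofNat] at hle
  linarith

lemma nonempty_iso_cycleGraph_of_le (hx : IsPerron G t x) (hG : G.Connected)
    (hr : 2 < graphRank G) (hn : Fintype.card V = 5)
    (hdiam : ∀ u v, u ≠ v → ¬ G.Adj u v → ∃ w, G.Adj u w ∧ G.Adj v w) (ht : t ≤ 2) :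
    Nonempty (G ≃g SimpleGraph.cycleGraph 5) := by
  have := hG.nonempty
  have ht2 : t ^ 2 ≤ 4 := by nlinarith [hx.nonneg]
  have hw : ∑ v, twoWalks G v ≤ 20 := by
    have := hx.sum_twoWalks_le
    rw [hn, Nat.cast_ofNat] at this
    exact_mod_cast (by linarith : ((∑ v, twoWalks G v : ℕ) : ℝ) ≤ 20)
  exact nonempty_iso_cycleGraph_five hn
    (degree_eq_two_of_sum_twoWalks_le (Or.inl hn) hG hr hdiam (by rw [hn]; omega)).2 hdiam

end SmallOrder

section SevenClasses

lemma add_le_mul_add_one {u v : ℕ} (hu : 1 ≤ u) (hv : 1 ≤ v) : u + v ≤ u * v + 1 := by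
  obtain ⟨u, rfl⟩ := Nat.exists_eq_add_of_le hu
  obtain ⟨v, rfl⟩ := Nat.exists_eq_add_of_le hv
  nlinarith [Nat.zero_le (u * v)]

lemma add_two_mul_le_mul_add_two {u v : ℕ} (hu : 2 ≤ u) (hv : 1 ≤ v) :
    u + 2 * v ≤ u * v + 2 := by
  obtain ⟨u, rfl⟩ := Nat.exists_eq_add_of_le hu
  obtain ⟨v, rfl⟩ := Nat.exists_eq_add_of_le hv
  nlinarith [Nat.zero_le (u * v)]

/-- Adjacency of the seven classes of `FarEdges.isLargeRadius_of_cross_left`. -/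
def oneSidedPattern : Fin 7 → Finset (Fin 7) :=
  ![{1, 2, 4, 6}, {0, 2, 4, 6}, {0, 1, 5, 6}, {5, 6}, {0, 1}, {2, 3}, {0, 1, 2, 3}]

/-- Adjacency of the seven classes of `FarEdges.isLargeRadius_of_inner_adj`. -/
def twoSidedPattern : Fin 7 → Finset (Fin 7) :=
  ![{1, 2, 4, 6}, {0, 3, 4, 6}, {0, 3, 5, 6}, {1, 2, 5, 6}, {0, 1}, {2, 3}, {0, 1, 2, 3}]

variable {n : Fin 7 → ℕ}

lemma sum_le_classWalks_oneSided (hn : ∀ i, 1 ≤ n i) :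
    (∀ k ∈ ({0, 1} : Finset (Fin 7)), ∑ i, n i ≤ classWalks oneSidedPattern n {0, 1} k + 1) ∨
      ∀ k ∈ ({2, 3} : Finset (Fin 7)), ∑ i, n i ≤ classWalks oneSidedPattern n {2, 3} k + 1 := by
  have w₀ : classWalks oneSidedPattern n {0, 1} 0 =
      (n 0 + n 1) * (n 2 + n 4 + n 6) + n 0 * n 1 := by simp [classWalks, oneSidedPattern]; ring
  have w₁ : classWalks oneSidedPattern n {0, 1} 1 =
      (n 0 + n 1) * (n 2 + n 4 + n 6) + n 0 * n 1 := by simp [classWalks, oneSidedPattern]; ring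
  have w₂ : classWalks oneSidedPattern n {2, 3} 2 =
      (n 0 + n 1) * n 2 + (n 2 + n 3) * (n 5 + n 6) := by simp [classWalks, oneSidedPattern]; ring
  have w₃ : classWalks oneSidedPattern n {2, 3} 3 = (n 2 + n 3) * (n 5 + n 6) := by
    simp [classWalks, oneSidedPattern]; ring
  rw [Fin.sum_univ_seven, Finset.forall_mem_insert, Finset.forall_mem_insert]
  simp only [Finset.mem_singleton, forall_eq, w₀, w₁, w₂, w₃]
  by_cases h : n 5 + n 3 + 2 ≤ n 0 + n 1 + (n 2 + n 4 + n 6)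
  · left
    have h1 := add_two_mul_le_mul_add_two (add_le_add (hn 0) (hn 1))
      ((hn 2).trans (by omega : n 2 ≤ n 2 + n 4 + n 6))
    have h2 := add_le_mul_add_one (hn 0) (hn 1)
    omega
  · right
    have h1 := add_le_mul_add_one (hn 3) (hn 5)
    have h2 : (1 + n 3) * (n 5 + 1) ≤ (n 2 + n 3) * (n 5 + n 6) :=
      Nat.mul_le_mul (Nat.add_le_add_right (hn 2) _) (Nat.add_le_add_left (hn 6) _)
    constructor <;> linarith [Nat.zero_le ((n 0 + n 1) * n 2)]

lemma sum_le_classWalks_twoSided_left (h0 : 1 ≤ n 0) (h1 : 1 ≤ n 1) (h2 : 1 ≤ n 2) (h3 : 1 ≤ n 3)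
    (h4 : 1 ≤ n 4) (h : n 5 + (n 2 + n 3) < n 0 + n 1 + (n 4 + n 6)) :
    ∀ k ∈ ({0, 1} : Finset (Fin 7)), ∑ i, n i ≤ classWalks twoSidedPattern n {0, 1} k + 1 := by
  have w₀ : classWalks twoSidedPattern n {0, 1} 0 =
      (n 0 + n 1) * (n 4 + n 6) + n 0 * n 1 + n 0 * n 2 := by
    simp [classWalks, twoSidedPattern]; ring
  have w₁ : classWalks twoSidedPattern n {0, 1} 1 =
      (n 0 + n 1) * (n 4 + n 6) + n 0 * n 1 + n 1 * n 3 := by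
    simp [classWalks, twoSidedPattern]; ring
  have hu := add_le_mul_add_one h0 h1
  have ha := add_two_mul_le_mul_add_two (add_le_add h0 h1) (h4.trans (Nat.le_add_right _ (n 6)))
  have h02 := Nat.mul_pos h0 h2
  have h13 := Nat.mul_pos h1 h3
  simp only [Finset.forall_mem_insert, Finset.mem_singleton, forall_eq, w₀, w₁,
    Fin.sum_univ_seven]
  omega

lemma sum_le_classWalks_twoSided_right (h0 : 1 ≤ n 0) (h1 : 1 ≤ n 1) (h2 : 1 ≤ n 2) (h3 : 1 ≤ n 3)
    (h5 : 1 ≤ n 5) (h : n 4 + (n 0 + n 1) < n 2 + n 3 + (n 5 + n 6)) :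
    ∀ k ∈ ({2, 3} : Finset (Fin 7)), ∑ i, n i ≤ classWalks twoSidedPattern n {2, 3} k + 1 := by
  have w₂ : classWalks twoSidedPattern n {2, 3} 2 =
      (n 2 + n 3) * (n 5 + n 6) + n 2 * n 3 + n 0 * n 2 := by
    simp [classWalks, twoSidedPattern]; ring
  have w₃ : classWalks twoSidedPattern n {2, 3} 3 =
      (n 2 + n 3) * (n 5 + n 6) + n 2 * n 3 + n 1 * n 3 := by
    simp [classWalks, twoSidedPattern]; ring
  have hw := add_le_mul_add_one h2 h3
  have hb := add_two_mul_le_mul_add_two (add_le_add h2 h3) (h5.trans (Nat.le_add_right _ (n 6)))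
  have h02 := Nat.mul_pos h0 h2
  have h13 := Nat.mul_pos h1 h3
  simp only [Finset.forall_mem_insert, Finset.mem_singleton, forall_eq, w₂, w₃,
    Fin.sum_univ_seven]
  omega

lemma sum_le_classWalks_twoSided_balanced (h0 : 1 ≤ n 0) (h1 : 1 ≤ n 1) (h2 : 1 ≤ n 2)
    (h3 : 1 ≤ n 3) (h4 : 1 ≤ n 4) (h5 : 1 ≤ n 5) (h6 : n 6 = 0)
    (h : n 4 + (n 0 + n 1) = n 5 + (n 2 + n 3)) :
    ∀ k ∈ ({0, 1, 2, 3} : Finset (Fin 7)),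
      ∑ i, n i ≤ classWalks twoSidedPattern n {0, 1, 2, 3} k := by
  have w₀ : classWalks twoSidedPattern n {0, 1, 2, 3} 0 =
      (n 1 + n 2) * (n 0 + n 3) + (n 0 + n 1) * n 4 := by
    simp [classWalks, twoSidedPattern, h6]; ring
  have w₁ : classWalks twoSidedPattern n {0, 1, 2, 3} 1 =
      (n 1 + n 2) * (n 0 + n 3) + (n 0 + n 1) * n 4 := by
    simp [classWalks, twoSidedPattern, h6]; ring
  have w₂ : classWalks twoSidedPattern n {0, 1, 2, 3} 2 =
      (n 1 + n 2) * (n 0 + n 3) + (n 2 + n 3) * n 5 := by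
    simp [classWalks, twoSidedPattern, h6]; ring
  have w₃ : classWalks twoSidedPattern n {0, 1, 2, 3} 3 =
      (n 1 + n 2) * (n 0 + n 3) + (n 2 + n 3) * n 5 := by
    simp [classWalks, twoSidedPattern, h6]; ring
  have hm := add_two_mul_le_mul_add_two (add_le_add h1 h2) (h0.trans (Nat.le_add_right _ (n 3)))
  have ha := add_two_mul_le_mul_add_two (add_le_add h0 h1) h4
  have hb := add_two_mul_le_mul_add_two (add_le_add h2 h3) h5
  simp only [Finset.forall_mem_insert, Finset.mem_singleton, forall_eq, w₀, w₁, w₂, w₃,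
    Fin.sum_univ_seven]
  omega

variable {V : Type*} [Fintype V] {G : SimpleGraph V} {t : ℝ} {z : V → ℝ} {κ : V → Fin 7}

/-- The lower bounds on the spectral radius which already rule out a graph of order `n ≥ 6`. -/
def IsLargeRadius (n : ℕ) (t : ℝ) : Prop :=
  7 ≤ n ∧ (n : ℝ) - 1 ≤ t ^ 2 ∨ n = 6 ∧ 16 / 3 ≤ t ^ 2

lemma one_le_card_colourClass {i : Fin 7} (h : ∃ v, κ v = i) : 1 ≤ (colourClass κ i).card :=
  Finset.card_pos.mpr (h.imp fun _ => mem_colourClass.mpr)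

lemma IsPerron.card_sub_one_le_sq (hz : IsPerron G t z) {N : Fin 7 → Finset (Fin 7)}
    (hN : ∀ i j, j ∈ N i ↔ i ∈ N j) (hG : ∀ u v, κ v ∈ N (κ u) → G.Adj u v) {S : Finset (Fin 7)}
    (hS : ∃ v, κ v ∈ S)
    (h : ∀ k ∈ S, ∑ i, (colourClass κ i).card ≤
      classWalks N (fun i => (colourClass κ i).card) S k + 1) :
    (Fintype.card V : ℝ) - 1 ≤ t ^ 2 := by
  obtain ⟨k, hk, hkt⟩ := hz.exists_classWalks_le_sq hN hG hS
  have hle := h k hk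
  rw [sum_card_colourClass] at hle
  have hle' : (Fintype.card V : ℝ) ≤ (classWalks N (fun i => (colourClass κ i).card) S k : ℝ) + 1 :=
    mod_cast hle
  linarith

lemma IsPerron.isLargeRadius_of_oneSidedPattern (hz : IsPerron G t z)
    (hκ : Function.Surjective κ) (hG : ∀ u v, κ v ∈ oneSidedPattern (κ u) → G.Adj u v) :
    IsLargeRadius (Fintype.card V) t := by
  have hN : ∀ i j, j ∈ oneSidedPattern i ↔ i ∈ oneSidedPattern j := by decide
  refine Or.inl ⟨by simpa using Fintype.card_le_of_surjective κ hκ, ?_⟩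
  rcases sum_le_classWalks_oneSided fun i => one_le_card_colourClass (hκ i) with h | h
  · exact hz.card_sub_one_le_sq hN hG ((hκ 0).imp fun v hv => by simp [hv]) h
  · exact hz.card_sub_one_le_sq hN hG ((hκ 2).imp fun v hv => by simp [hv]) h

lemma IsPerron.isLargeRadius_of_twoSidedPattern (hz : IsPerron G t z)
    (hκ : ∀ i, i ≠ 6 → ∃ v, κ v = i) (hG : ∀ u v, κ v ∈ twoSidedPattern (κ u) → G.Adj u v) :
    IsLargeRadius (Fintype.card V) t := by
  have hN : ∀ i j, j ∈ twoSidedPattern i ↔ i ∈ twoSidedPattern j := by decide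
  obtain ⟨h0, h1, h2, h3, h4, h5⟩ : 1 ≤ (colourClass κ 0).card ∧ 1 ≤ (colourClass κ 1).card ∧
      1 ≤ (colourClass κ 2).card ∧ 1 ≤ (colourClass κ 3).card ∧ 1 ≤ (colourClass κ 4).card ∧
      1 ≤ (colourClass κ 5).card := by
    refine ⟨?_, ?_, ?_, ?_, ?_, ?_⟩ <;> exact one_le_card_colourClass (hκ _ (by decide))
  have hcard := sum_card_colourClass κ
  rw [Fin.sum_univ_seven] at hcard
  by_cases hl : (colourClass κ 5).card + ((colourClass κ 2).card + (colourClass κ 3).card) <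
      (colourClass κ 0).card + (colourClass κ 1).card +
        ((colourClass κ 4).card + (colourClass κ 6).card)
  · exact Or.inl ⟨by omega, hz.card_sub_one_le_sq hN hG
      ((hκ 0 (by decide)).imp fun v hv => by simp [hv])
      (sum_le_classWalks_twoSided_left h0 h1 h2 h3 h4 hl)⟩
  by_cases hr : (colourClass κ 4).card + ((colourClass κ 0).card + (colourClass κ 1).card) <
      (colourClass κ 2).card + (colourClass κ 3).card +
        ((colourClass κ 5).card + (colourClass κ 6).card)
  · exact Or.inl ⟨by omega, hz.card_sub_one_le_sq hN hG
      ((hκ 2 (by decide)).imp fun v hv => by simp [hv])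
      (sum_le_classWalks_twoSided_right h0 h1 h2 h3 h5 hr)⟩
  obtain ⟨k, hk, hkt⟩ := hz.exists_classWalks_le_sq hN hG (S := {0, 1, 2, 3})
    ((hκ 0 (by decide)).imp fun v hv => by simp [hv])
  have hle := sum_le_classWalks_twoSided_balanced (n := fun i => (colourClass κ i).card)
    h0 h1 h2 h3 h4 h5 (by omega) (by omega) k hk
  rw [sum_card_colourClass] at hle
  have hle' : (Fintype.card V : ℝ) ≤ t ^ 2 := (Nat.cast_le.mpr hle).trans hkt
  rcases (show 6 ≤ Fintype.card V by omega).eq_or_lt with h6 | h7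
  · refine Or.inr ⟨h6.symm, ?_⟩
    rw [← h6] at hle'
    norm_num at hle' ⊢
    linarith
  · exact Or.inl ⟨h7, by linarith⟩

end SevenClasses

lemma exists_crossing_adj {V : Type*} {G : SimpleGraph V} (hG : G.Connected) {S : Set V} {a b : V}
    (ha : a ∈ S) (hb : b ∉ S) : ∃ u v, u ∈ S ∧ v ∉ S ∧ G.Adj u v := by
  obtain ⟨w⟩ := hG.preconnected a b
  obtain ⟨d, -, hd⟩ := w.exists_boundary_dart S ha hb
  exact ⟨d.fst, d.snd, hd.1, hd.2, d.adj⟩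

namespace FarEdges

variable {V : Type*} [Fintype V] {G : SimpleGraph V} {p x q y u v w : V}

lemma outer_adj (h : FarEdges G p x q y) (hr : graphRank G = 5) (hG : G.Connected)
    (hp : ¬ G.Adj p w) (hq : ¬ G.Adj q w) : G.Adj w x ∨ G.Adj w y := by
  have hw : x ∉ ({w} : Set V) := fun hw => hp ((show x = w from hw) ▸ h.px)
  obtain ⟨u, v, rfl, -, huv⟩ := exists_crossing_adj hG (Set.mem_singleton w) hw
  by_cases hpv : G.Adj p v
  · exact Or.inl ((h.outer_adj_iff hr hp hq hpv).mp huv)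
  by_cases hqv : G.Adj q v
  · exact Or.inr ((h.symm.outer_adj_iff hr hq hp hqv).mp huv)
  · exact absurd huv (h.outer_not_adj hr hp hq hpv hqv)

lemma inner_not_adj (h : FarEdges G p x q y) (hr : graphRank G = 5)
    (hy : ∀ v, G.Adj q v → ¬ G.Adj y v) (hu : G.Adj q u) (hv : G.Adj q v) : ¬ G.Adj u v := by
  simp [h.symm.inner_adj_iff hr hu hv, hy u hu, hy v hv]

lemma cross_iff (h : FarEdges G p x q y) (hr : graphRank G = 5)
    (hy : ∀ v, G.Adj q v → ¬ G.Adj y v) :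
    (∀ u v, G.Adj p u → G.Adj q v → (G.Adj u v ↔ G.Adj u y)) ∨
      ((∀ u v, G.Adj p u → G.Adj q v → (G.Adj u v ↔ G.Adj x v)) ∧
        (∃ v, G.Adj q v ∧ G.Adj x v) ∧ ∃ v, G.Adj q v ∧ ¬ G.Adj x v) := by
  have hc u v (hu : G.Adj p u) (hv : G.Adj q v) := h.cross_iff_or hr hu hv (Or.inr (hy v hv))
  have hqy := h.qy
  by_cases hx : ∀ v, G.Adj q v → (G.Adj x v ↔ G.Adj x y)
  · left
    intro u v hu hv
    have := hc u v hu hv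
    have := hx v hv
    tauto
  · right
    push Not at hx
    obtain ⟨v₁, hv₁, hne⟩ := hx
    have huy u (hu : G.Adj p u) : G.Adj u y ↔ G.Adj x y := by
      have := hc u v₁ hu hv₁
      tauto
    refine ⟨fun u v hu hv => ?_, ?_⟩
    · have := hc u v hu hv
      have := huy u hu
      tauto
    · by_cases hxy : G.Adj x y
      · exact ⟨⟨y, hqy, hxy⟩, v₁, hv₁, by tauto⟩
      · exact ⟨⟨v₁, hv₁, by tauto⟩, y, hqy, hxy⟩

lemma exists_isLinked_of_cross_right (h : FarEdges G p x q y) (hr : graphRank G = 5)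
    (hG : G.Connected) (hx : ∃ u, G.Adj p u ∧ G.Adj x u) (hy : ∀ v, G.Adj q v → ¬ G.Adj y v)
    (hc : ∀ u v, G.Adj p u → G.Adj q v → (G.Adj u v ↔ G.Adj u y)) : ∃ κ r, IsLinked G κ r := by
  have hsymm u v (h : G.Adj u v) : G.Adj v u := h.symm
  have hirr (v : V) : ¬ G.Adj v v := G.irrefl
  have ⟨hpx, hqy, hpq, hcom⟩ := h
  have houter u v := h.outer_not_adj (w := u) (v := v) hr
  have hleft u v := h.outer_adj_iff (w := u) (u := v) hr
  have hright u v := h.symm.outer_adj_iff (w := u) (u := v) hr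
  have hinner u v := h.inner_adj_iff (u := u) (v := v) hr
  have hindep u v := h.inner_not_adj (u := u) (v := v) hr hy
  have hor v := h.outer_adj (w := v) hr hG
  obtain ⟨u₀, hpu, hxu⟩ := hx
  let κ (v : V) : Fin 5 :=
    if G.Adj p v then if G.Adj x v then 1 else 0
    else if G.Adj q v then 3 else if G.Adj x v then 2 else 4
  have hblob u v : κ u < 3 → κ v < 3 → (G.Adj u v ↔ κ u ≠ κ v) := by
    simp only [κ]
    split_ifs <;> simp <;> grind
  have hleaf u v : κ u = 4 → (G.Adj u v ↔ κ v = 3) := by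
    simp only [κ]
    split_ifs <;> simp <;> grind
  have hcentre u v : κ u = 3 → κ v = 3 → ¬ G.Adj u v := by
    simp only [κ]
    split_ifs <;> simp
    grind
  obtain ⟨r, v, hκr, hκv, hrv⟩ := exists_crossing_adj hG (S := {v | κ v < 3}) (a := x) (b := q)
    (by simp only [κ, Set.mem_ofPred_eq]; grind) (by simp only [κ, Set.mem_ofPred_eq]; grind)
  refine ⟨κ, r, hblob, hleaf, hcentre, hκr, fun w hw => ?_, fun i => ?_⟩
  · have hv : κ v = 3 := by
      have := hleaf v r
      have := hrv.symm
      grind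
    have hqv : G.Adj q v := by simp only [κ] at hv; grind
    have hqw : G.Adj q w := by simp only [κ] at hw; grind
    simp only [κ] at hκr
    grind
  · refine ⟨![x, u₀, p, y, q] i, ?_⟩
    fin_cases i <;> simp [κ] <;> grind

lemma exists_isLinked_of_cross_left (h : FarEdges G p x q y) (hr : graphRank G = 5)
    (hG : G.Connected) (hx : ∃ u, G.Adj p u ∧ G.Adj x u) (hy : ∀ v, G.Adj q v → ¬ G.Adj y v)
    (hc : ∀ u v, G.Adj p u → G.Adj q v → (G.Adj u v ↔ G.Adj x v))
    (hy₁ : ∃ v, G.Adj q v ∧ G.Adj x v) (hy₂ : ∃ v, G.Adj q v ∧ ¬ G.Adj x v)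
    (hw : ∀ w, ¬ G.Adj p w → ¬ G.Adj q w → G.Adj w x → ¬ G.Adj w y) :
    ∃ κ r, IsLinked G κ r := by
  have hsymm u v (h : G.Adj u v) : G.Adj v u := h.symm
  have hirr (v : V) : ¬ G.Adj v v := G.irrefl
  have ⟨hpx, _, hpq, hcom⟩ := h
  have houter u v := h.outer_not_adj (w := u) (v := v) hr
  have hleft u v := h.outer_adj_iff (w := u) (u := v) hr
  have hright u v := h.symm.outer_adj_iff (w := u) (u := v) hr
  have hinner u v := h.inner_adj_iff (u := u) (v := v) hr
  have hindep u v := h.inner_not_adj (u := u) (v := v) hr hy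
  have hor v := h.outer_adj (w := v) hr hG
  obtain ⟨u₀, hpu, hxu⟩ := hx
  obtain ⟨y₁, hqy₁, hxy₁⟩ := hy₁
  obtain ⟨y₂, hqy₂, hxy₂⟩ := hy₂
  have hcentre u v (hpu : ¬ G.Adj p u) (hpv : ¬ G.Adj p v) (hxv : G.Adj x v)
      (hu : G.Adj q u ∨ G.Adj x u) : ¬ G.Adj u v := by
    by_cases hqu : G.Adj q u <;> by_cases hqv : G.Adj q v
    · exact hindep u v hqu hqv
    · exact fun huv => hw v hpv hqv hxv.symm ((hright v u hqv hpv hqu).mp huv.symm)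
    · have hxu := (hu.resolve_left hqu).symm
      exact fun huv => hw u hpu hqu hxu ((hright u v hqu hpu hqv).mp huv)
    · exact houter u v hpu hqu hpv hqv
  let κ (v : V) : Fin 5 :=
    if G.Adj p v then if G.Adj x v then 1 else 0
    else if G.Adj x v then 2 else if G.Adj q v then 4 else 3
  refine ⟨κ, y₁, fun u v => ?_, fun u v => ?_, fun u v => ?_, ?_, fun v => ?_, fun i => ?_⟩
  · simp only [κ]
    split_ifs <;> simp <;> grind
  · simp only [κ]
    split_ifs <;> simp <;> grind
  · simp only [κ]
    split_ifs <;> simp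
    grind
  · simp only [κ]; grind
  · simp only [κ]; grind
  · refine ⟨![x, u₀, p, q, y₂] i, ?_⟩
    fin_cases i <;> simp [κ] <;> grind

lemma isLargeRadius_of_cross_left (h : FarEdges G p x q y) (hr : graphRank G = 5)
    (hG : G.Connected) (hx : ∃ u, G.Adj p u ∧ G.Adj x u)
    (hc : ∀ u v, G.Adj p u → G.Adj q v → (G.Adj u v ↔ G.Adj x v))
    (hy₁ : ∃ v, G.Adj q v ∧ G.Adj x v) (hy₂ : ∃ v, G.Adj q v ∧ ¬ G.Adj x v)
    (hw : ∃ w, ¬ G.Adj p w ∧ ¬ G.Adj q w ∧ G.Adj w x ∧ G.Adj w y) {t : ℝ} {z : V → ℝ}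
    (hz : IsPerron G t z) : IsLargeRadius (Fintype.card V) t := by
  have hsymm u v (h : G.Adj u v) : G.Adj v u := h.symm
  have (v : V) : ¬ G.Adj v v := G.irrefl
  have ⟨hpx, hqy, hpq, hcom⟩ := h
  have hleft u v := h.outer_adj_iff (w := u) (u := v) hr
  have hright u v := h.symm.outer_adj_iff (w := u) (u := v) hr
  have hinner u v := h.inner_adj_iff (u := u) (v := v) hr
  have hor v := h.outer_adj (w := v) hr hG
  obtain ⟨u₀, hpu, hxu⟩ := hx
  obtain ⟨y₁, hqy₁, hxy₁⟩ := hy₁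
  obtain ⟨y₂, hqy₂, hxy₂⟩ := hy₂
  obtain ⟨w, hpw, hqw, hwx, hwy⟩ := hw
  let κ (v : V) : Fin 7 :=
    if G.Adj p v then if G.Adj x v then 1 else 0
    else if G.Adj q v then if G.Adj x v then 2 else 3
    else if G.Adj x v then if G.Adj y v then 6 else 4 else 5
  refine hz.isLargeRadius_of_oneSidedPattern (κ := κ) (fun i => ?_) fun u v => ?_
  · refine ⟨![x, u₀, y₁, y₂, p, q, w] i, ?_⟩
    fin_cases i <;> simp [κ] <;> grind
  · simp only [κ]
    split_ifs <;> simp [oneSidedPattern] <;> grind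

lemma isLargeRadius_of_inner_adj (h : FarEdges G p x q y) (hr : graphRank G = 5)
    (hG : G.Connected) (hxy : G.Adj x y) (hx : ∃ u, G.Adj p u ∧ G.Adj x u)
    (hy : ∃ v, G.Adj q v ∧ G.Adj y v) {t : ℝ} {z : V → ℝ} (hz : IsPerron G t z) :
    IsLargeRadius (Fintype.card V) t := by
  obtain ⟨u₀, hpu, hxu⟩ := hx
  obtain ⟨v₀, hqv, hyv⟩ := hy
  obtain ⟨-, hxv₀, hu₀y⟩ := (h.cross_of_adj hr hpu hqv hxu hyv).1 hxy
  have hcross u v (hu : G.Adj p u) (hv : G.Adj q v) (huv : G.Adj x u ↔ G.Adj y v) :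
      G.Adj u v := by
    by_cases hyv' : G.Adj y v
    · exact ((h.cross_of_adj hr hu hv (huv.mpr hyv') hyv').1 hxy).1
    · have hxu' := mt huv.mp hyv'
      have hxv : ¬ G.Adj u₀ v ∧ G.Adj x v := by
        simpa [hxy, hu₀y] using h.cross_iff_or hr hpu hv (Or.inr hyv')
      have huy : ¬ G.Adj u v₀ ∧ G.Adj u y := by
        simpa [hxy, hxv₀] using h.cross_iff_or hr hu hqv (Or.inl hxu')
      simpa [hxy, hxv.2, huy.2] using h.cross_iff_or hr hu hv (Or.inl hxu')
  have hinner u v := h.inner_adj_iff (u := u) (v := v) hr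
  have hinner' u v := h.symm.inner_adj_iff (u := u) (v := v) hr
  have houter u v (hpu : ¬ G.Adj p u) (hqu : ¬ G.Adj q u) (hpv : G.Adj p v) :=
    (h.outer_adj_iff hr hpu hqu hpv).trans (G.adj_comm u x)
  have houter' u v (hpu : ¬ G.Adj p u) (hqu : ¬ G.Adj q u) (hqv : G.Adj q v) :=
    (h.symm.outer_adj_iff hr hqu hpu hqv).trans (G.adj_comm u y)
  have hor v (hpv : ¬ G.Adj p v) (hqv : ¬ G.Adj q v) : G.Adj x v ∨ G.Adj y v :=
    (h.outer_adj hr hG hpv hqv).imp SimpleGraph.Adj.symm SimpleGraph.Adj.symm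
  let κ (v : V) : Fin 7 :=
    if G.Adj p v then if G.Adj x v then 1 else 0
    else if G.Adj q v then if G.Adj y v then 3 else 2
    else if G.Adj x v then if G.Adj y v then 6 else 4 else 5
  refine hz.isLargeRadius_of_twoSidedPattern (κ := κ) (fun i hi => ?_) fun u v => ?_
  · have ⟨hpx, hqy, hpq, hcom⟩ := h
    refine ⟨![x, u₀, y, v₀, p, q, q] i, ?_⟩
    fin_cases i <;> simp [κ] <;> grind
  · have hsymm := G.adj_comm u v
    have := h.common
    simp only [κ]
    split_ifs <;> simp [twoSidedPattern] <;> grind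

lemma isLinked_or_isLargeRadius_of_inner (h : FarEdges G p x q y) (hr : graphRank G = 5)
    (hG : G.Connected) (hx : ∃ u, G.Adj p u ∧ G.Adj x u) {t : ℝ} {z : V → ℝ}
    (hz : IsPerron G t z) : (∃ κ r, IsLinked G κ r) ∨ IsLargeRadius (Fintype.card V) t := by
  by_cases hy : ∃ v, G.Adj q v ∧ G.Adj y v
  · right
    by_cases hxy : G.Adj x y
    · exact h.isLargeRadius_of_inner_adj hr hG hxy hx hy hz
    · obtain ⟨u, hpu, hxu⟩ := hx
      obtain ⟨v, hqv, hyv⟩ := hy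
      have hxv := (h.cross_of_adj hr hpu hqv hxu hyv).2 hxy
      have h' : FarEdges G p x q v := ⟨h.px, hqv, h.pq, h.common⟩
      exact h'.isLargeRadius_of_inner_adj hr hG hxv ⟨u, hpu, hxu⟩ ⟨y, h.qy, hyv.symm⟩ hz
  · push Not at hy
    rcases h.cross_iff hr hy with hc | ⟨hc, hy₁, hy₂⟩
    · exact Or.inl (h.exists_isLinked_of_cross_right hr hG hx hy hc)
    by_cases hw : ∃ w, ¬ G.Adj p w ∧ ¬ G.Adj q w ∧ G.Adj w x ∧ G.Adj w y
    · exact Or.inr (h.isLargeRadius_of_cross_left hr hG hx hc hy₁ hy₂ hw hz)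
    · push Not at hw
      exact Or.inl (h.exists_isLinked_of_cross_left hr hG hx hy hc hy₁ hy₂ hw)

end FarEdges

lemma isLinked_or_isLargeRadius_or_diam_two {V : Type*} [Fintype V] {G : SimpleGraph V}
    (hr : graphRank G = 5) (hG : G.Connected) {t : ℝ} {z : V → ℝ} (hz : IsPerron G t z) :
    (∃ κ r, IsLinked G κ r) ∨ IsLargeRadius (Fintype.card V) t ∨
      ∀ u v, u ≠ v → ¬ G.Adj u v → ∃ w, G.Adj u w ∧ G.Adj v w := by
  by_cases hd : ∀ u v, u ≠ v → ¬ G.Adj u v → ∃ w, G.Adj u w ∧ G.Adj v w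
  · exact Or.inr (Or.inr hd)
  push Not at hd
  obtain ⟨p, q, hne, hpq, hcom⟩ := hd
  have : Nontrivial V := ⟨p, q, hne⟩
  obtain ⟨x, hx⟩ := hG.preconnected.exists_adj_of_nontrivial p
  obtain ⟨y, hy⟩ := hG.preconnected.exists_adj_of_nontrivial q
  have h : FarEdges G p x q y := ⟨hx, hy, hpq, hcom⟩
  refine Or.imp_right Or.inl ?_
  rcases h.exists_inner_adj hr with hx | hy
  · exact h.isLinked_or_isLargeRadius_of_inner hr hG hx hz
  · exact h.symm.isLinked_or_isLargeRadius_of_inner hr hG hy hz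

/-- `t` is the relevant root of the equation satisfied by the spectral radius of
`G₁₀ ∘ (1, 1, 1, 1, m - 1, s - 1)`, namely the one at which both factors are positive. -/
structure IsSecularRoot (m s : ℕ) (t : ℝ) : Prop where
  pos : 0 < t
  pos_left : 0 < t ^ 2 - t - 2 * m
  eq : (t ^ 2 - t - 2 * m) * (t ^ 2 - s) = 2

lemma exists_isSecularRoot (m s : ℕ) : ∃ t, IsSecularRoot m s t := by
  have : (0 : ℝ) ≤ m := Nat.cast_nonneg m
  have : (0 : ℝ) ≤ s := Nat.cast_nonneg s
  obtain ⟨a, ha, ha₀⟩ : ∃ a : ℝ, 1 ≤ a ∧ a ^ 2 - a - 2 * m = 0 := by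
    have hsq : √(1 + 8 * (m : ℝ)) ^ 2 = 1 + 8 * m := Real.sq_sqrt (by positivity)
    have hle : 1 ≤ √(1 + 8 * (m : ℝ)) := Real.one_le_sqrt.mpr (by linarith)
    exact ⟨(1 + √(1 + 8 * m)) / 2, by linarith, by linarith⟩
  set b : ℝ := 2 * m + s + 3
  have hab : a ≤ b := by nlinarith
  have hcont : ContinuousOn (fun t : ℝ => (t ^ 2 - t - 2 * m) * (t ^ 2 - s)) (Set.Icc a b) := by
    fun_prop
  have hfa : (a ^ 2 - a - 2 * m) * (a ^ 2 - s) ≤ 2 := by rw [ha₀, zero_mul]; exact two_pos.le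
  have hfb : 2 ≤ (b ^ 2 - b - 2 * m) * (b ^ 2 - s) := by
    have h₁ : 2 ≤ b ^ 2 - b - 2 * m := by nlinarith
    have : 1 ≤ b ^ 2 - s := by nlinarith
    nlinarith
  obtain ⟨t, ⟨hat, -⟩, ht⟩ := intermediate_value_Icc hab hcont ⟨hfa, hfb⟩
  have hP : 0 ≤ t ^ 2 - t - 2 * m := by nlinarith
  exact ⟨t, by linarith, hP.lt_of_ne' fun h => by simp [h] at ht, ht⟩

namespace IsSecularRoot

variable {m s : ℕ} {t t' : ℝ}

lemma pos_right (h : IsSecularRoot m s t) : 0 < t ^ 2 - s :=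
  pos_of_mul_pos_right (by rw [h.eq]; exact two_pos) h.pos_left.le

lemma le (h : IsSecularRoot m s t) (ht' : 0 < t') (hP' : 0 < t' ^ 2 - t' - 2 * m)
    (h' : 2 ≤ (t' ^ 2 - t' - 2 * m) * (t' ^ 2 - s)) : t ≤ t' := by
  by_contra! hlt
  have : (0 : ℝ) ≤ m := Nat.cast_nonneg m
  have h1 : 1 < t' := by nlinarith
  have hP : t' ^ 2 - t' - 2 * m < t ^ 2 - t - 2 * m := by nlinarith
  have hQ : t' ^ 2 - s < t ^ 2 - s := by nlinarith
  have hQ' : 0 < t' ^ 2 - s := pos_of_mul_pos_right (two_pos.trans_le h') hP'.le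
  exact (h'.trans_lt (mul_lt_mul'' hP hQ hP'.le hQ'.le)).ne' h.eq

lemma lt_of_isLargeRadius (h : IsSecularRoot 1 s t) (ht' : 0 ≤ t') (hl : IsLargeRadius (s + 3) t') :
    t < t' := by
  obtain ⟨hpos, hP, hlt⟩ : 0 < t' ∧ 0 < t' ^ 2 - t' - 2 * (1 : ℕ) ∧
      2 < (t' ^ 2 - t' - 2 * (1 : ℕ)) * (t' ^ 2 - s) := by
    rcases hl with ⟨h7, hle⟩ | ⟨h6, hle⟩
    · have hs : (4 : ℝ) ≤ s := by exact_mod_cast (by omega : 4 ≤ s)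
      push_cast at hle ⊢
      have ht : 2.4 ≤ t' := by nlinarith
      have hP : 1.3 ≤ t' ^ 2 - t' - 2 := by nlinarith
      exact ⟨by linarith, by linarith, by nlinarith⟩
    · obtain rfl : s = 3 := by omega
      push_cast
      have ht : 2.3 ≤ t' := by nlinarith
      have hP : 0.99 ≤ t' ^ 2 - t' - 2 := by nlinarith
      exact ⟨by linarith, by linarith, by nlinarith⟩
  refine (h.le hpos hP hlt.le).lt_of_ne fun hne => ?_
  rw [← hne, h.eq] at hlt
  exact lt_irrefl _ hlt

end IsSecularRoot

lemma IsLinked.exists_isSecularRoot_le {V : Type*} [Fintype V] {G : SimpleGraph V}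
    {κ : V → Fin 5} {r : V} (h : IsLinked G κ r) {t : ℝ} {x : V → ℝ} (hx : IsPerron G t x) :
    ∃ m s τ, 1 ≤ m ∧ 2 ≤ s ∧ m + s + 2 = Fintype.card V ∧ IsSecularRoot m s τ ∧ τ ≤ t ∧
      (τ = t → Nonempty (G ≃g blowup G10 ![1, 1, 1, 1, m - 1, s - 1])) := by
  obtain ⟨κ, h, hr⟩ := h.exists_root_eq_zero
  have hcard (i : Fin 5) : 1 ≤ (colourClass κ i).card := by exact_mod_cast h.one_le_card i
  have hsum := sum_card_colourClass κ
  rw [Fin.sum_univ_five] at hsum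
  have h0 := hcard 0
  have h1 := hcard 1
  have h2 := hcard 2
  have h3 := hcard 3
  have h4 := hcard 4
  obtain ⟨m, hm⟩ := Nat.exists_eq_add_of_le'
    (by omega : 2 ≤ (colourClass κ 0).card + (colourClass κ 1).card + (colourClass κ 2).card)
  obtain ⟨ht, hP, hle, heq⟩ := h.secular hr hx hm rfl
  obtain ⟨τ, hτ⟩ := exists_isSecularRoot m ((colourClass κ 3).card + (colourClass κ 4).card)
  refine ⟨m, _, τ, by omega, by omega, by omega, hτ, hτ.le ht hP hle, ?_⟩
  rintro rfl
  obtain ⟨hd, hb, hc, hlink⟩ := heq hτ.eq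
  have e := h.nonempty_iso hr hb hc hd hlink
  rwa [show (colourClass κ 0).card = m by omega,
    show (colourClass κ 4).card = (colourClass κ 3).card + (colourClass κ 4).card - 1 by omega] at e

lemma exists_isSecularRoot_le {V : Type*} [Fintype V] {G : SimpleGraph V} (hG : G.Connected)
    (hr : graphRank G = 5) (hn : 6 ≤ Fintype.card V) {t : ℝ} {x : V → ℝ} (hx : IsPerron G t x) :
    ∃ m s τ, 1 ≤ m ∧ 2 ≤ s ∧ m + s + 2 = Fintype.card V ∧ IsSecularRoot m s τ ∧ τ ≤ t ∧
      (τ = t → Nonempty (G ≃g blowup G10 ![1, 1, 1, 1, m - 1, s - 1])) := by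
  have := hG.nonempty
  suffices h : (∃ κ r, IsLinked G κ r) ∨ IsLargeRadius (Fintype.card V) t by
    rcases h with ⟨κ, r, h⟩ | h
    · exact h.exists_isSecularRoot_le hx
    obtain ⟨s, hs⟩ := Nat.exists_eq_add_of_le' (by omega : 3 ≤ Fintype.card V)
    obtain ⟨τ, hτ⟩ := exists_isSecularRoot 1 s
    have hlt := hτ.lt_of_isLargeRadius hx.nonneg (hs ▸ h)
    exact ⟨1, s, τ, le_rfl, by omega, by omega, hτ, hlt.le, fun h => absurd h hlt.ne⟩
  rcases isLinked_or_isLargeRadius_or_diam_two hr hG hx with h | h | hdiam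
  · exact Or.inl h
  · exact Or.inr h
  rcases hn.lt_or_eq with h7 | h6
  · exact Or.inr (Or.inl ⟨h7, le_sq_of_diam_two hx hG hdiam⟩)
  · exact Or.inr (Or.inr ⟨h6.symm, le_sq_of_card_six hx hG (by omega) h6.symm hdiam⟩)

/-- The parameters `m`, `s` minimise the spectral radius `t` of `G₁₀ ∘ (1, 1, 1, 1, m - 1, s - 1)`
among the graphs of this family with `n` vertices. -/
structure IsOptimal (n m s : ℕ) (t : ℝ) : Prop extends IsSecularRoot m s t where
  one_le : 1 ≤ m
  two_le : 2 ≤ s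
  order : m + s + 2 = n
  min : ∀ m' s' t', 1 ≤ m' → 2 ≤ s' → m' + s' + 2 = n → IsSecularRoot m' s' t' → t ≤ t'

lemma exists_isOptimal {n : ℕ} (hn : 6 ≤ n) : ∃ m s t, IsOptimal n m s t := by
  choose τ hτ using fun m : ℕ => exists_isSecularRoot m (n - 2 - m)
  obtain ⟨m, hm, hmin⟩ :=
    Finset.exists_min_image (Finset.Icc 1 (n - 4)) τ (Finset.nonempty_Icc.mpr (by omega))
  rw [Finset.mem_Icc] at hm
  refine ⟨m, n - 2 - m, τ m, hτ m, hm.1, by omega, by omega, fun m' s' t' h1 h2 h3 h => ?_⟩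
  obtain rfl : s' = n - 2 - m' := by omega
  exact (hmin m' (Finset.mem_Icc.mpr ⟨h1, by omega⟩)).trans
    ((hτ m').le h.pos h.pos_left h.eq.ge)

lemma irrational_of_sq_add_self_eq_one {Q : ℝ} (hQ : Q ^ 2 + Q = 1) : Irrational Q := by
  rintro ⟨q, rfl⟩
  have hirr : Irrational √((5 : ℕ) : ℝ) := Nat.Prime.irrational_sqrt (by norm_num)
  have h5 : ((5 : ℕ) : ℝ) = (2 * q + 1) ^ 2 := by push_cast; linarith
  rw [h5, Real.sqrt_sq_eq_abs] at hirr
  exact hirr ⟨|2 * q + 1|, by push_cast; rfl⟩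

lemma intCast_sub_sq_ne_add_intCast {Q : ℝ} (hQ : Q ^ 2 + Q = 1) (hQ0 : 0 < Q) {j : ℤ}
    (hj : 0 < j - Q) (s : ℤ) : (j - Q) ^ 2 ≠ Q + s := by
  intro h
  have hlin : (2 * (j : ℝ) + 2) * Q = j ^ 2 + 1 - s := by linarith
  by_cases h0 : 2 * (j : ℝ) + 2 = 0
  · linarith
  · refine irrational_of_sq_add_self_eq_one hQ ⟨(j ^ 2 + 1 - s) / (2 * j + 2), ?_⟩
    push_cast
    rw [← hlin, mul_div_cancel_left₀ _ h0]

namespace IsOptimal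

variable {n m s : ℕ} {t : ℝ}

lemma secular_le (h : IsOptimal n m s t) {m' s' : ℕ} (h1 : 1 ≤ m') (h2 : 2 ≤ s')
    (h3 : m' + s' + 2 = n) (hP : 0 < t ^ 2 - t - 2 * m') :
    (t ^ 2 - t - 2 * m') * (t ^ 2 - s') ≤ 2 := by
  obtain ⟨τ, hτ⟩ := exists_isSecularRoot m' s'
  by_contra! hlt
  obtain rfl : τ = t := (hτ.le h.pos hP hlt.le).antisymm (h.min m' s' τ h1 h2 h3 hτ)
  exact hlt.ne' hτ.eq

lemma left_le (h : IsOptimal n m s t) (hs : 3 ≤ s) :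
    t ^ 2 - t - 2 * m ≤ 2 * (t ^ 2 - s) + 2 := by
  have hQ := h.pos_right
  by_cases hP : 0 < t ^ 2 - t - 2 * ((m + 1 : ℕ) : ℝ)
  · have h1 := h.secular_le (m' := m + 1) (s' := s - 1) (by omega) (by omega)
      (by have := h.order; omega) hP
    rw [Nat.cast_sub (by omega)] at h1
    push_cast at h1
    nlinarith [h.eq]
  · push_cast at hP
    linarith

lemma two_mul_right_le (h : IsOptimal n m s t) (hm : 2 ≤ m) :
    2 * (t ^ 2 - s) ≤ t ^ 2 - t - 2 * m + 2 := by
  have hcast : ((m - 1 : ℕ) : ℝ) = m - 1 := by rw [Nat.cast_sub (by omega)]; norm_num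
  have h1 := h.secular_le (m' := m - 1) (s' := s + 1) (by omega) (by have := h.two_le; omega)
      (by have := h.order; omega) (by rw [hcast]; have := h.pos_left; linarith)
  rw [hcast] at h1
  push_cast at h1
  nlinarith [h.eq]

-- If `m < m'` were both optimal, then `m' = m + 1` and `Q = t² - s` would satisfy `Q² + Q = 1`,
-- while `t + Q` and `t² - Q` are integers.
lemma param_le (h : IsOptimal n m s t) {m' s' : ℕ} (h' : IsOptimal n m' s' t) : m' ≤ m := by
  by_contra! hlt
  have ho := h.order
  have ho' := h'.order
  obtain ⟨d, rfl⟩ := Nat.exists_eq_add_of_lt hlt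
  obtain rfl : s = s' + d + 1 := by omega
  have : (0 : ℝ) ≤ d := Nat.cast_nonneg d
  have hle := h.left_le (by have := h'.two_le; omega)
  have e := h.eq
  have e' := h'.eq
  have hQ := h.pos_right
  push_cast at hle e e' hQ
  have hP : t ^ 2 - t - 2 * m = 2 * (t ^ 2 - (s' + d + 1)) + 2 * (d + 1) := by
    have : ((d : ℝ) + 1) *
        (t ^ 2 - t - 2 * m - (2 * (t ^ 2 - (s' + d + 1)) + 2 * (d + 1))) = 0 := by
      linear_combination e' - e
    exact sub_eq_zero.mp ((mul_eq_zero.mp this).resolve_left (by positivity))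
  have hd0 : (d : ℝ) = 0 := by linarith
  rw [hd0] at e hP hQ
  rw [hP] at e
  have ht : ((s' + 1 - 2 * m - 2 : ℤ) : ℝ) - (t ^ 2 - (s' + 0 + 1)) = t := by
    push_cast
    linarith
  refine intCast_sub_sq_ne_add_intCast (Q := t ^ 2 - (s' + 0 + 1)) (by linarith) hQ
    (ht.symm ▸ h.pos) (s' + 1) ?_
  rw [ht]
  push_cast
  ring

lemma unique (h : IsOptimal n m s t) {m' s' : ℕ} (h' : IsOptimal n m' s' t) : m' = m :=
  le_antisymm (h.param_le h') (h'.param_le h)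

lemma four_le (h : IsOptimal n m s t) : 4 ≤ t ^ 2 - t - 2 * m + 2 * (t ^ 2 - s) := by
  nlinarith [h.eq, h.pos_left, h.pos_right, sq_nonneg (t ^ 2 - t - 2 * m - 2 * (t ^ 2 - s))]

lemma one_lt (h : IsOptimal n m s t) : 1 < t := by
  have hm : (1 : ℝ) ≤ m := by exact_mod_cast h.one_le
  nlinarith [h.pos_left, h.pos]

lemma sqrt_le (h : IsOptimal n m s t) : √(24 * (n : ℝ) + 1) ≤ 6 * t - 1 := by
  have hn : (n : ℝ) = m + s + 2 := by exact_mod_cast h.order.symm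
  have ht := h.one_lt
  have h4 := h.four_le
  exact Real.sqrt_le_iff.mpr ⟨by linarith, by linarith⟩

lemma le_eighteen_mul (h : IsOptimal n m s t) :
    6 * n - 1 - √(24 * (n : ℝ) + 1) - 9 * (t ^ 2 - t - 2 * m) ≤ 18 * (m : ℝ) := by
  have hw : √(24 * (n : ℝ) + 1) ^ 2 = 24 * n + 1 := Real.sq_sqrt (by positivity)
  have ht := h.one_lt
  nlinarith [mul_nonneg (sub_nonneg.mpr h.sqrt_le)
    (by linarith [Real.sqrt_nonneg (24 * (n : ℝ) + 1)] : 0 ≤ 6 * t - 5 + √(24 * (n : ℝ) + 1))]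

lemma eighteen_mul_le (h : IsOptimal n m s t) :
    18 * (m : ℝ) ≤
      6 * n - 13 - √(24 * (n : ℝ) + 1) + 6 * (t ^ 2 - s - (t ^ 2 - t - 2 * m)) := by
  have hn : (n : ℝ) = m + s + 2 := by exact_mod_cast h.order.symm
  linarith [h.sqrt_le]

lemma eighteen_mul_lt (h : IsOptimal n m s t) (hm : 2 ≤ m) :
    18 * (m : ℝ) < 6 * n - 1 - √(24 * (n : ℝ) + 1) := by
  linarith [h.eighteen_mul_le, h.two_mul_right_le hm, h.pos_right]

lemma lt_eighteen_mul (h : IsOptimal n m s t) (hs : 3 ≤ s) :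
    6 * n - 37 - √(24 * (n : ℝ) + 1) < 18 * (m : ℝ) := by
  have hP : t ^ 2 - t - 2 * m < 4 := by nlinarith [h.left_le hs, h.pos_left, h.eq]
  linarith [h.le_eighteen_mul]

lemma three_le (h : IsOptimal n m s t) (hn : 6 ≤ n) : 3 ≤ s := by
  have ho := h.order
  have h2 := h.two_le
  by_contra hs
  have : s = 2 := by omega
  have h3 := h.eighteen_mul_lt (by omega)
  have hm : (m : ℝ) = n - 4 := by
    have : ((m + 4 : ℕ) : ℝ) = n := by exact_mod_cast (by omega : m + 4 = n)
    push_cast at this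
    linarith
  have hn6 : (6 : ℝ) ≤ n := by exact_mod_cast hn
  have := Real.sqrt_nonneg (24 * (n : ℝ) + 1)
  linarith

lemma eq_floor_or_ceil (h : IsOptimal n m s t) (hn : 12 ≤ n) :
    ((m - 1 : ℕ) : ℤ) = ⌊(6 * (n : ℝ) - 37 - √(24 * (n : ℝ) + 1)) / 18⌋ ∨
      ((m - 1 : ℕ) : ℤ) = ⌈(6 * (n : ℝ) - 37 - √(24 * (n : ℝ) + 1)) / 18⌉ := by
  have h1 := h.one_le
  have hlow := h.lt_eighteen_mul (h.three_le (by omega))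
  have hn12 : (12 : ℝ) ≤ n := by exact_mod_cast hn
  have hup : 18 * (m : ℝ) < 6 * n - 1 - √(24 * (n : ℝ) + 1) := by
    rcases h1.lt_or_eq with h2 | h2
    · exact h.eighteen_mul_lt h2
    · have : √(24 * (n : ℝ) + 1) ≤ 6 * n - 37 := by
        rw [Real.sqrt_le_left (by linarith)]
        nlinarith
      rw [← h2]
      push_cast
      linarith
  have hcast : (((m - 1 : ℕ) : ℤ) : ℝ) = m - 1 := by
    push_cast [Nat.cast_sub h1]; ring
  by_cases hk : (m : ℝ) - 1 ≤ (6 * (n : ℝ) - 37 - √(24 * (n : ℝ) + 1)) / 18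
  · left
    symm
    rw [Int.floor_eq_iff, hcast]
    constructor <;> linarith
  · right
    symm
    rw [Int.ceil_eq_iff, hcast]
    constructor <;> linarith

lemma eq_one (h : IsOptimal n m s t) (hn : n ≤ 10) : m = 1 := by
  have h1 := h.one_le
  by_contra hne
  have h2 : 2 ≤ m := by omega
  have hup := h.eighteen_mul_lt h2
  have hn10 : (n : ℝ) ≤ 10 := by exact_mod_cast hn
  have ho : (m : ℝ) + s + 2 = n := by exact_mod_cast h.order
  have hw : 5 ≤ √(24 * (n : ℝ) + 1) := by
    have : (1 : ℝ) ≤ n := by exact_mod_cast (by have := h.order; omega : 1 ≤ n)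
    rw [Real.le_sqrt' (by norm_num)]
    linarith
  have hm3 : m < 3 := by
    have : (m : ℝ) < 3 := by linarith
    exact_mod_cast this
  have hm : m = 2 := by omega
  subst hm
  have hle := h.two_mul_right_le le_rfl
  have e := h.eq
  have hP := h.pos_left
  have hQ := h.pos_right
  push_cast at hle e hP ho
  set P := t ^ 2 - t - 2 * 2
  set Q := t ^ 2 - (s : ℝ)
  have hP12 : 1.2 ≤ P := by
    by_contra! hlt
    nlinarith
  have hQ17 : Q ≤ 1.67 := by nlinarith
  have ht : t ^ 2 < 2.77 ^ 2 := by linarith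
  have : t < 2.77 := lt_of_pow_lt_pow_left₀ 2 (by norm_num) ht
  nlinarith [h.pos]

lemma eq_two (h : IsOptimal n m s t) (hn : n = 11) : m = 2 := by
  have h1 := h.one_le
  have ho := h.order
  rcases h1.lt_or_eq with h2 | h2
  · have hup := h.eighteen_mul_lt h2
    have hw : 12 ≤ √(24 * (n : ℝ) + 1) := by
      rw [hn, Real.le_sqrt' (by norm_num)]
      norm_num
    have hm3 : m < 3 := by
      have hn' : (n : ℝ) = 11 := by exact_mod_cast hn
      have : (m : ℝ) < 3 := by linarith
      exact_mod_cast this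
    omega
  · exfalso
    have hs : s = 8 := by omega
    have hle := h.left_le (by omega)
    have e := h.eq
    have hP := h.pos_left
    have hQ := h.pos_right
    subst hs
    subst h2
    push_cast at hle e hP hQ
    have hP33 : t ^ 2 - t - 2 * 1 ≤ 3.3 := by
      by_contra! hlt
      nlinarith
    have ht : t ≤ 2.9 := by
      by_contra!
      nlinarith
    have : t ^ 2 - 8 ≤ 0.5 := by nlinarith [h.pos]
    nlinarith

end IsOptimal

lemma IsOptimal.isTheMinimizer {n m s : ℕ} {t : ℝ} (h : IsOptimal n m s t) (hn : 6 ≤ n) :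
    IsTheMinimizer.{u} n 5 (blowup G10 ![1, 1, 1, 1, m - 1, s - 1]) := by
  obtain ⟨k, rfl⟩ := Nat.exists_eq_add_of_le' h.one_le
  obtain ⟨j, rfl⟩ := Nat.exists_eq_add_of_le' (one_le_two.trans h.two_le)
  have hj : 0 < j := by have := h.two_le; omega
  obtain ⟨x, hx⟩ := exists_isPerron_blowup_G10 h.pos (by exact_mod_cast h.pos_left)
    (by exact_mod_cast h.eq)
  have hconn := connected_blowup_G10 k j
  have := hconn.nonempty
  refine hx.isTheMinimizer ((card_blowup_G10 k j).trans (by have := h.order; omega)) hconn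
    (graphRank_blowup_G10 k hj) fun {K τ y} hK hKr hy => ?_
  obtain ⟨m', s', τ', h1, h2, h3, hτ', hle, hiso⟩ :=
    exists_isSecularRoot_le hK hKr (by rwa [Fintype.card_fin]) hy
  rw [Fintype.card_fin] at h3
  have hmin := h.min m' s' τ' h1 h2 h3 hτ'
  refine ⟨hmin.trans hle, ?_⟩
  rintro rfl
  obtain rfl := hle.antisymm hmin
  obtain rfl := h.unique ⟨hτ', h1, h2, h3, h.min⟩
  obtain rfl : s' = j + 1 := by have := h.order; omega
  exact hiso rfl

lemma two_lt_or_diam_two {V : Type*} [Fintype V] {G : SimpleGraph V} {t : ℝ} {x : V → ℝ}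
    (hn : Fintype.card V = 5) (hG : G.Connected) (hr : graphRank G = 5) (hx : IsPerron G t x) :
    2 < t ∨ ∀ u v, u ≠ v → ¬ G.Adj u v → ∃ w, G.Adj u w ∧ G.Adj v w := by
  rcases isLinked_or_isLargeRadius_or_diam_two hr hG hx with ⟨κ, r, h⟩ | h | hdiam
  · left
    obtain ⟨m, s, τ, hm, -, -, hτ, hle, -⟩ := h.exists_isSecularRoot_le hx
    have hm : (1 : ℝ) ≤ m := by exact_mod_cast hm
    have := hτ.pos_left
    have := hτ.pos
    nlinarith
  · rcases h with ⟨h7, -⟩ | ⟨h6, -⟩ <;> omega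
  · exact Or.inr hdiam

lemma isTheMinimizer_cycleGraph_five : IsTheMinimizer.{u} 5 5 (SimpleGraph.cycleGraph 5) := by
  refine isPerron_cycleGraph_five.isTheMinimizer (Fintype.card_fin 5)
    SimpleGraph.cycleGraph_connected graphRank_cycleGraph_five fun {K τ y} hK hKr hy => ?_
  rcases two_lt_or_diam_two (Fintype.card_fin 5) hK hKr hy with hlt | hdiam
  · exact ⟨hlt.le, fun h => absurd h hlt.ne'⟩
  · have := hK.nonempty
    have hsq := le_sq_of_diam_two hy hK hdiam
    rw [Fintype.card_fin] at hsq
    push_cast at hsq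
    have hτ := hy.nonneg
    exact ⟨by nlinarith, fun h =>
      nonempty_iso_cycleGraph_of_le hy hK (by omega) (Fintype.card_fin 5) hdiam h.le⟩

end RankFive

theorem theorem2 (n : ℕ) :
    (n = 5 → RankFive.IsTheMinimizer.{u, 0} n 5 (SimpleGraph.cycleGraph 5)) ∧
    (6 ≤ n → n ≤ 10 →
      RankFive.IsTheMinimizer.{u, 0} n 5 (RankFive.blowup RankFive.G1 ![1, 1, 1, 1, n - 4])) ∧
    (n = 11 →
      RankFive.IsTheMinimizer.{u, 0} n 5 (RankFive.blowup RankFive.G10 ![1, 1, 1, 1, 1, n - 5])) ∧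
    (12 ≤ n → ∃ k : ℕ,
      ((k : ℤ) = ⌊(6 * (n : ℝ) - 37 - Real.sqrt (24 * (n : ℝ) + 1)) / 18⌋ ∨
        (k : ℤ) = ⌈(6 * (n : ℝ) - 37 - Real.sqrt (24 * (n : ℝ) + 1)) / 18⌉) ∧
      RankFive.IsTheMinimizer.{u, 0} n 5
        (RankFive.blowup RankFive.G10 ![1, 1, 1, 1, k, n - k - 4])) := by
  refine ⟨?_, fun h6 h10 => ?_, fun h11 => ?_, fun h12 => ?_⟩
  · rintro rfl
    exact RankFive.isTheMinimizer_cycleGraph_five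
  · obtain ⟨m, s, t, h⟩ := RankFive.exists_isOptimal h6
    have hmin := h.isTheMinimizer h6
    have hm := h.eq_one h10
    have ho := h.order
    rw [show m - 1 = 0 by omega, show s - 1 = n - 4 by omega] at hmin
    obtain ⟨e⟩ := RankFive.nonempty_iso_blowup_G1 (n - 4)
    exact hmin.of_iso e.symm
  · obtain ⟨m, s, t, h⟩ := RankFive.exists_isOptimal (show 6 ≤ n by omega)
    have hmin := h.isTheMinimizer (by omega)
    have hm := h.eq_two h11
    have ho := h.order
    rwa [show m - 1 = 1 by omega, show s - 1 = n - 5 by omega] at hmin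
  · obtain ⟨m, s, t, h⟩ := RankFive.exists_isOptimal (show 6 ≤ n by omega)
    have hmin := h.isTheMinimizer (by omega)
    have hm := h.one_le
    have ho := h.order
    refine ⟨m - 1, h.eq_floor_or_ceil h12, ?_⟩
    rwa [show s - 1 = n - (m - 1) - 4 by omega] at hmin
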